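/- Let $\Gamma_0(\sqrt{-2})$ be the subgroup of $\mathrm{SL}_2(\mathbb{Z}[\sqrt{-2}])$ consisting of the matrices $\begin{pmatrix} a & b\\ c & d\end{pmatrix}$ whose entry $c$ lies in the ideal $\langle\sqrt{-2}\rangle$ of $\mathbb{Z}[\sqrt{-2}]$. Then the group cohomology of $\Gamma_0(\sqrt{-2})$ with trivial coefficients $\mathbb{F}_2$ is finite-dimensional in every degree, with $$\dim_{\mathbb{F}_2} H^p(\Gamma_0(\sqrt{-2});\mathbb{F}_2)=\begin{cases}1, & p=0,\\ 4, & p=1,\\ 6, & p\ge 2 \text{ and } p\equiv 2 \text{ or } 3 \pmod 4,\\ 5, & p\ge 2\text{ and } p\equiv 0 \text{ or } 1 \pmod 4.\end{cases}$$ -/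

import Mathlib

/-- For a commutative ring `R` and `r : R`, the subgroup of `SL₂(R)` of matrices
`(a, b; c, d)` whose lower left entry `c` lies in the ideal `⟨r⟩`. -/
def congruenceGamma0 {R : Type} [CommRing R] (r : R) :
    Subgroup (Matrix.SpecialLinearGroup (Fin 2) R) where
  carrier := {g | g.1 1 0 ∈ Ideal.span {r}}
  one_mem' := by simp
  mul_mem' {a b} ha hb := by
    have h : (a * b).1 1 0 = a.1 1 0 * b.1 0 0 + a.1 1 1 * b.1 1 0 := by
      simp [Matrix.mul_apply, Fin.sum_univ_two]
    change (a * b).1 1 0 ∈ Ideal.span {r}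
    rw [h]
    exact Ideal.add_mem _ (Ideal.mul_mem_right _ _ ha) (Ideal.mul_mem_left _ _ hb)
  inv_mem' {a} ha := by
    change a⁻¹.1 1 0 ∈ Ideal.span {r}
    have h : a⁻¹.1 1 0 = - a.1 1 0 := by
      simp [Matrix.SpecialLinearGroup.SL2_inv_expl a]
    rw [h]
    exact neg_mem ha

/-- `Γ₀(√-2)` inside `SL₂(ℤ[√-2])`; here `Zsqrtd.sqrtd = √-2` in `ℤ√(-2) = ℤ[√-2]`. -/
abbrev Gamma0SqrtNegTwo : Subgroup (Matrix.SpecialLinearGroup (Fin 2) (ℤ√(-2))) :=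
  congruenceGamma0 (Zsqrtd.sqrtd : ℤ√(-2))

/-- `H^p(Γ₀(√-2); 𝔽₂)`, group cohomology with trivial coefficients `𝔽₂`. -/
noncomputable abbrev cohomologyGamma0SqrtNegTwo (p : ℕ) : ModuleCat (ZMod 2) :=
  groupCohomology (Rep.trivial (ZMod 2) Gamma0SqrtNegTwo (ZMod 2)) p

/-!
The group `Γ₀(√-2)` acts on a contractible two-dimensional complex obtained by retracting
hyperbolic three-space. Up to the action it has two vertices, with quaternion stabilizers `⟨I, W⟩`
and `⟨I, R⟩`, three edges, with stabilizers `⟨I⟩`, `⟨W⟩`, `⟨R⟩` cyclic of order four, and one face,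
with stabilizer `±1`. The periodic resolutions of these stabilizers, glued along chain maps and one
homotopy, assemble into a free resolution of `𝔽₂` over `𝔽₂[Γ₀(√-2)]` with as many generators
in degree `n` as vertex, edge and face resolutions provide in degrees `n`, `n - 1` and `n - 2`.

The geometry enters only through exactness of the cellular part, which is checked by counting
modulo two: if a subset `S` of the group is almost invariant in the sense that crossing an edge
leaves `S` only at prescribed elements, then counting the terms of a chain in the translates of `S`
reads off its coefficients on that edge. The sets used are the sides of hyperbolic planes and of
their translates, given by signs of explicit integral quadratic functions of the matrix entries.
Exactness at the vertices amounts to generation of the group by the stabilizers and the elements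
gluing the edges, and follows from the Euclidean algorithm in `ℤ[√-2]`.

After augmentation, every block of the differential vanishes except the one from edges to vertices,
whose rank is `1, 2, 0, 0` with period four; the dimensions follow by counting generators.
-/

noncomputable section

namespace MatrixResolution

open CategoryTheory MonoidAlgebra

universe u

section RowVectors

variable (k G : Type u) [CommRing k] [Group G]

/-- The augmentation `k[G] → k` sending every group element to `1`. -/
def aug : k[G] →ₐ[k] k := MonoidAlgebra.lift k k G 1

variable {k G} in
@[simp] lemma aug_single (g : G) (r : k) : aug k G (single g r) = r := by
  simp [aug, MonoidAlgebra.lift_single]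

/-- The representation of `G` on row vectors over `k[G]` by left multiplication, so that right
multiplication by a matrix over `k[G]` is equivariant. -/
def rowRep (I : Type u) : Representation k G (I → k[G]) where
  toFun g :=
    { toFun := fun x i => single g 1 * x i
      map_add' := fun x y => by ext1 i; simp [mul_add]
      map_smul' := fun r x => by ext1 i; simp }
  map_one' := by ext1 x; funext i; simp [← MonoidAlgebra.one_def]
  map_mul' g h := by
    ext1 x; funext i; simp [← mul_assoc, MonoidAlgebra.single_mul_single]

/-- The row vectors `rowRep` as an object of `Rep k G`. -/
abbrev RowRep (I : Type u) : Rep k G := Rep.of (rowRep k G I)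

variable {k G}

lemma rowRep_apply {I : Type u} (g : G) (x : I → k[G]) (i : I) :
    rowRep k G I g x i = single g 1 * x i := rfl

lemma leftRegular_apply (g : G) (x : k[G]) :
    Representation.leftRegular k G g x = single g 1 * x := by
  induction x using MonoidAlgebra.induction_linear with
  | zero => simp
  | add x y hx hy => rw [map_add, hx, hy, mul_add]
  | single h r => simp [MonoidAlgebra.single_mul_single]

/-- Row vectors over a finite index type form the free representation. -/
def freeIsoRowRep (I : Type u) [Finite I] : Rep.free k G I ≅ RowRep k G I :=
  Rep.mkIso <| .mk (Finsupp.linearEquivFunOnFinite k (k[G]) I) fun g => by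
    refine Finsupp.lhom_ext fun i y => ?_
    classical
    funext j
    by_cases hij : i = j
    · subst hij
      simp only [LinearMap.comp_apply, LinearEquiv.coe_coe, Representation.finsupp_single,
        Finsupp.linearEquivFunOnFinite_apply, Finsupp.single_eq_same, rowRep_apply]
      exact leftRegular_apply g y
    · simp [rowRep_apply, hij]

instance (I : Type u) [Finite I] : Projective (RowRep k G I) :=
  Projective.of_iso (freeIsoRowRep I) inferInstance

variable {I J : Type u} [Fintype I]

/-- The morphism of representations `x ↦ x ᵥ* M`. -/
def rowHom (M : Matrix I J (k[G])) : RowRep k G I ⟶ RowRep k G J :=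
  Rep.ofHom
    { toFun := fun x => Matrix.vecMul x M
      map_add' := fun x y => Matrix.add_vecMul ..
      map_smul' := fun r x => Matrix.smul_vecMul ..
      isIntertwining' := fun g => by
        ext1 x
        funext j
        simp [rowRep_apply, Matrix.vecMul, dotProduct, Finset.mul_sum, mul_assoc] }

variable (k G) in
/-- The morphism from row vectors to the trivial representation given by a column vector `v`
over `k`. -/
def trivialHom (v : I → k) : RowRep k G I ⟶ Rep.trivial k G k :=
  Rep.ofHom
    { toFun := fun x => ∑ i, aug k G (x i) * v i
      map_add' := fun x y => by simp [Finset.sum_add_distrib, add_mul]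
      map_smul' := fun r x => by simp [Finset.mul_sum, mul_assoc]
      isIntertwining' := fun g => LinearMap.ext fun x => by simp [rowRep_apply] }

lemma trivialHom_apply (v : I → k) (x : I → k[G]) :
    (trivialHom k G v).hom x = ∑ i, aug k G (x i) * v i := rfl

lemma trivialHom_one_apply (x : I → k[G]) :
    (trivialHom k G (1 : I → k)).hom x = ∑ i, aug k G (x i) := by
  rw [trivialHom_apply]
  simp only [Pi.one_apply, mul_one]

variable [DecidableEq I]

omit [Fintype I] in
lemma hom_trivial_single (f : RowRep k G I ⟶ Rep.trivial k G k) (i : I) (y : k[G]) :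
    f.hom (Pi.single i y : I → k[G]) = aug k G y * f.hom (Pi.single i 1 : I → k[G]) := by
  induction y using MonoidAlgebra.induction_linear with
  | zero => simp
  | add x y hx hy => rw [Pi.single_add, map_add, hx, hy, map_add, add_mul]
  | single g r =>
    have hsingle : (RowRep k G I).ρ g (r • Pi.single i 1 : I → k[G]) =
        (Pi.single i (single g r) : I → k[G]) := by
      funext j
      change single g 1 * (r • Pi.single i 1 : I → k[G]) j = _
      by_cases hij : j = i
      · subst hij
        simp
      · simp [hij]
    have hcomm := Rep.hom_comm_apply f g (r • Pi.single i 1 : I → k[G])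
    rw [hsingle] at hcomm
    rw [hcomm, map_smul, aug_single]
    rfl

lemma hom_trivial_apply (f : RowRep k G I ⟶ Rep.trivial k G k) (x : I → k[G]) :
    f.hom x = ∑ i, aug k G (x i) * f.hom (Pi.single i 1 : I → k[G]) := by
  conv_lhs => rw [← Finset.univ_sum_single x, map_sum]
  exact Finset.sum_congr rfl fun i _ => hom_trivial_single f i (x i)

variable (k G I) in
/-- Morphisms from row vectors to the trivial representation are column vectors over `k`. -/
def homTrivialEquiv : (RowRep k G I ⟶ Rep.trivial k G k) ≃ₗ[k] (I → k) where
  toFun f i := f.hom (Pi.single i 1 : I → k[G])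
  map_add' _ _ := rfl
  map_smul' _ _ := rfl
  invFun := trivialHom k G
  left_inv f := Rep.hom_ext <| Representation.IntertwiningMap.ext <| LinearMap.ext fun x =>
    (hom_trivial_apply f x).symm
  right_inv v := by
    funext i
    refine (trivialHom_apply v _).trans ?_
    rw [Finset.sum_eq_single i] <;> simp +contextual

end RowVectors

/-- The matrices `D n` over `k[G]`, acting on row vectors from the right, form a resolution of the
trivial module `k` by free modules, the augmentation in degree `0` being the sum of the
augmentations of the entries. -/
structure IsResolution (k G : Type u) [CommRing k] [Group G] (I : ℕ → Type u) [∀ n, Fintype (I n)]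
    (D : ∀ n, Matrix (I (n + 1)) (I n) (k[G])) : Prop where
  nonempty : Nonempty (I 0)
  mul_eq_zero : ∀ n, D (n + 1) * D n = 0
  aug_eq_zero : ∀ i, ∑ j, aug k G (D 0 i j) = 0
  exact_zero : ∀ x : I 0 → k[G], ∑ i, aug k G (x i) = 0 → ∃ y, Matrix.vecMul y (D 0) = x
  exact_succ : ∀ n, ∀ x : I (n + 1) → k[G], Matrix.vecMul x (D n) = 0 →
    ∃ y, Matrix.vecMul y (D (n + 1)) = x

section Complex

variable {k G : Type u} [CommRing k] [Group G] {I : ℕ → Type u} [∀ n, Fintype (I n)]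
  {D : ∀ n, Matrix (I (n + 1)) (I n) (k[G])}

/-- The chain complex of row vectors with differentials `x ↦ x ᵥ* D n`. -/
def complex (hD : ∀ n, D (n + 1) * D n = 0) : ChainComplex (Rep k G) ℕ :=
  ChainComplex.of (fun n => RowRep k G (I n)) (fun n => rowHom (D n)) fun n => by
    refine Rep.hom_ext (Representation.IntertwiningMap.ext (LinearMap.ext fun x => ?_))
    change Matrix.vecMul (Matrix.vecMul x (D (n + 1))) (D n) = 0
    rw [Matrix.vecMul_vecMul, hD, Matrix.vecMul_zero]

lemma complex_d (hD : ∀ n, D (n + 1) * D n = 0) (n : ℕ) :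
    (complex hD).d (n + 1) n = rowHom (D n) := by
  simp [complex]

/-- The augmentation of `complex`, as a morphism to the trivial module in degree `0`. -/
def complexπ (h : IsResolution k G I D) :
    complex h.mul_eq_zero ⟶ (ChainComplex.single₀ (Rep k G)).obj (Rep.trivial k G k) :=
  ((complex h.mul_eq_zero).toSingle₀Equiv _).symm ⟨trivialHom k G (1 : I 0 → k), by
    rw [complex_d]
    refine Rep.hom_ext (Representation.IntertwiningMap.ext (LinearMap.ext fun x => ?_))
    refine (trivialHom_one_apply (Matrix.vecMul x (D 0))).trans ?_
    simp only [Matrix.vecMul, dotProduct, map_sum, map_mul]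
    rw [Finset.sum_comm]
    simp [← Finset.mul_sum, h.aug_eq_zero]⟩

lemma trivialHom_one_surjective {J : Type u} [Fintype J] (hJ : Nonempty J) :
    Function.Surjective (trivialHom k G (1 : J → k)).hom := by
  classical
  intro r
  refine ⟨(Pi.single hJ.some (single 1 r) : J → k[G]), ?_⟩
  rw [trivialHom_one_apply, Finset.sum_eq_single hJ.some] <;> simp +contextual

lemma quasiIso_complexπ (h : IsResolution k G I D) : QuasiIso (complexπ h) where
  quasiIsoAt m := by
    induction m with
    | zero =>
      rw [ChainComplex.quasiIsoAt₀_iff, ShortComplex.quasiIso_iff_of_zeros' _ rfl rfl rfl]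
      refine ⟨(forget₂ _ (ModuleCat k)).reflects_exact_of_faithful _ ?_,
        (Rep.epi_iff_surjective _).mpr (trivialHom_one_surjective h.nonempty)⟩
      rw [ShortComplex.moduleCat_exact_iff]
      intro (x : I 0 → k[G]) hx
      obtain ⟨y, hy⟩ := h.exact_zero x ((trivialHom_one_apply x).symm.trans hx)
      exact ⟨y, (congrArg (fun f => f.hom y) (complex_d h.mul_eq_zero 0)).trans hy⟩
    | succ m _ =>
      rw [quasiIsoAt_iff_exactAt' (hL := ChainComplex.exactAt_succ_single_obj ..),
          HomologicalComplex.exactAt_iff' _ (m + 2) (m + 1) m (by simp) (by simp)]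
      apply (forget₂ _ (ModuleCat k)).reflects_exact_of_faithful
      rw [ShortComplex.moduleCat_exact_iff]
      intro (x : I (m + 1) → k[G]) hx
      obtain ⟨y, hy⟩ := h.exact_succ m x
        ((congrArg (fun f => f.hom x) (complex_d h.mul_eq_zero m)).symm.trans hx)
      exact ⟨y, (congrArg (fun f => f.hom y) (complex_d h.mul_eq_zero (m + 1))).trans hy⟩

/-- The projective resolution of the trivial module given by matrices over `k[G]`. -/
def resolution (h : IsResolution k G I D) : ProjectiveResolution (Rep.trivial k G k) where
  complex := complex h.mul_eq_zero
  projective n := inferInstanceAs (Projective (RowRep k G (I n)))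
  π := complexπ h
  quasiIso := quasiIso_complexπ h

lemma map_aug_mul_map_aug (hD : ∀ n, D (n + 1) * D n = 0) (n : ℕ) :
    (D (n + 1)).map (aug k G) * (D n).map (aug k G) = 0 := by
  simpa [Matrix.map_mul] using congrArg (fun M => M.map (aug k G)) (hD n)

/-- The cochain complex of column vectors over `k` with the augmented matrices as
differentials. -/
def cochains (hD : ∀ n, D (n + 1) * D n = 0) : CochainComplex (ModuleCat k) ℕ :=
  CochainComplex.of (fun n => ModuleCat.of k (I n → k))
    (fun n => ModuleCat.ofHom (Matrix.mulVecLin ((D n).map (aug k G)))) fun n => by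
    ext1
    refine LinearMap.ext fun x => ?_
    change Matrix.mulVec _ (Matrix.mulVec _ x) = 0
    rw [Matrix.mulVec_mulVec, map_aug_mul_map_aug hD, Matrix.zero_mulVec]

lemma cochains_d (hD : ∀ n, D (n + 1) * D n = 0) (n : ℕ) :
    (cochains hD).d n (n + 1) =
      ModuleCat.ofHom (Matrix.mulVecLin ((D n).map (aug k G))) := by
  simp [cochains]

/-- Applying `Hom(-, k)` to the complex of row vectors gives the complex of column vectors. -/
def homComplexIso [∀ n, DecidableEq (I n)] (hD : ∀ n, D (n + 1) * D n = 0) :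
    (complex hD).linearYonedaObj k (Rep.trivial k G k) ≅ cochains hD :=
  HomologicalComplex.Hom.isoOfComponents
    (fun n => (homTrivialEquiv k G (I n)).toModuleIso) <| by
    rintro i j ⟨rfl⟩
    rw [cochains_d]
    ext1
    refine LinearMap.ext fun (f : RowRep k G (I i) ⟶ Rep.trivial k G k) => funext fun l => ?_
    have hcomp : homTrivialEquiv k G (I (i + 1)) ((complex hD).d (i + 1) i ≫ f) l =
        f.hom (Matrix.vecMul (Pi.single l 1) (D i)) := by
      rw [complex_d]; rfl
    refine Eq.symm (hcomp.trans ?_)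
    rw [hom_trivial_apply, Matrix.single_one_vecMul]
    rfl

/-- Group cohomology is the cohomology of the complex of augmented matrices. -/
def cohomologyIso [∀ n, DecidableEq (I n)] (h : IsResolution k G I D) (n : ℕ) :
    groupCohomology (Rep.trivial k G k) n ≅ (cochains h.mul_eq_zero).homology n :=
  groupCohomologyIso _ n (resolution h) ≪≫
    HomologicalComplex.homologyMapIso (homComplexIso h.mul_eq_zero) n

end Complex

section Field

variable {k : Type u} [Field k]

lemma finite_homology (S : ShortComplex (ModuleCat.{u} k)) [Module.Finite k S.X₂] :
    Module.Finite k S.homology :=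
  let e : S.homology ≃ₗ[k] (LinearMap.ker S.g.hom ⧸ LinearMap.range S.moduleCatToCycles) :=
    S.moduleCatHomologyIso.toLinearEquiv
  Module.Finite.equiv e.symm

lemma finrank_homology_add_rank_add_rank (S : ShortComplex (ModuleCat.{u} k))
    [Module.Finite k S.X₂] :
    Module.finrank k S.homology + Module.finrank k (LinearMap.range S.g.hom) +
      Module.finrank k (LinearMap.range S.f.hom) = Module.finrank k S.X₂ := by
  have hquot := Submodule.finrank_quotient_add_finrank (LinearMap.range S.moduleCatToCycles)
  have hker := LinearMap.finrank_range_add_finrank_ker S.g.hom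
  have hrange : Module.finrank k (LinearMap.range S.moduleCatToCycles) =
      Module.finrank k (LinearMap.range S.f.hom) := by
    refine (congrArg (fun W : Submodule k _ => Module.finrank k W)
      (LinearMap.range_codRestrict _ S.f.hom S.moduleCat_zero_apply)).trans
      (LinearEquiv.finrank_eq (Submodule.comapSubtypeEquivOfLe ?_))
    rintro _ ⟨x, rfl⟩
    exact S.moduleCat_zero_apply x
  have hhom : Module.finrank k S.homology =
      Module.finrank k (LinearMap.ker S.g.hom ⧸ LinearMap.range S.moduleCatToCycles) :=
    S.moduleCatHomologyIso.toLinearEquiv.finrank_eq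
  omega

variable {G : Type u} [Group G] {I : ℕ → Type u} [∀ n, Fintype (I n)]
  {D : ∀ n, Matrix (I (n + 1)) (I n) (k[G])}

lemma finite_groupCohomology (h : IsResolution k G I D) (n : ℕ) :
    Module.Finite k (groupCohomology (Rep.trivial k G k) n) := by
  classical
  have : Module.Finite k ((cochains h.mul_eq_zero).sc n).X₂ :=
    inferInstanceAs (Module.Finite k (I n → k))
  have : Module.Finite k ((cochains h.mul_eq_zero).homology n) := finite_homology _
  exact Module.Finite.equiv (cohomologyIso h n).toLinearEquiv.symm

lemma finrank_groupCohomology_zero_add_rank (h : IsResolution k G I D) :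
    Module.finrank k (groupCohomology (Rep.trivial k G k) 0) + ((D 0).map (aug k G)).rank =
      Fintype.card (I 0) := by
  classical
  let K := cochains h.mul_eq_zero
  have hiso := (cohomologyIso h 0 ≪≫
    K.homologyIsoSc' 0 0 1 (by simp) (by simp)).toLinearEquiv.finrank_eq
  have : Module.Finite k (K.sc' 0 0 1).X₂ := inferInstanceAs (Module.Finite k (I 0 → k))
  have hrank := finrank_homology_add_rank_add_rank (K.sc' 0 0 1)
  have hf : (K.sc' 0 0 1).f.hom = 0 := congrArg ModuleCat.Hom.hom (K.shape 0 0 (by simp))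
  have hg : (K.sc' 0 0 1).g.hom = Matrix.mulVecLin ((D 0).map (aug k G)) :=
    congrArg ModuleCat.Hom.hom (cochains_d h.mul_eq_zero 0)
  have hcard : Module.finrank k (K.sc' 0 0 1).X₂ = Fintype.card (I 0) :=
    Module.finrank_fintype_fun_eq_card k
  rw [hf, hg, LinearMap.range_zero, finrank_bot, add_zero, ← hiso] at hrank
  exact hrank.trans hcard

lemma finrank_groupCohomology_succ_add_rank_add_rank (h : IsResolution k G I D) (n : ℕ) :
    Module.finrank k (groupCohomology (Rep.trivial k G k) (n + 1)) +
      ((D (n + 1)).map (aug k G)).rank + ((D n).map (aug k G)).rank =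
      Fintype.card (I (n + 1)) := by
  classical
  let K := cochains h.mul_eq_zero
  let S := K.sc' n (n + 1) (n + 2)
  have hiso := (cohomologyIso h (n + 1) ≪≫
    K.homologyIsoSc' n (n + 1) (n + 2) (by simp) (by simp)).toLinearEquiv.finrank_eq
  have : Module.Finite k S.X₂ := inferInstanceAs (Module.Finite k (I (n + 1) → k))
  have hrank := finrank_homology_add_rank_add_rank S
  have hf : S.f.hom = Matrix.mulVecLin ((D n).map (aug k G)) :=
    congrArg ModuleCat.Hom.hom (cochains_d h.mul_eq_zero n)
  have hg : S.g.hom = Matrix.mulVecLin ((D (n + 1)).map (aug k G)) :=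
    congrArg ModuleCat.Hom.hom (cochains_d h.mul_eq_zero (n + 1))
  have hcard : Module.finrank k S.X₂ = Fintype.card (I (n + 1)) :=
    Module.finrank_fintype_fun_eq_card k
  rw [hf, hg, ← hiso] at hrank
  exact hrank.trans hcard

end Field

open Matrix

/-- The family `I` of index types shifted up by one degree. -/
def Shift (I : ℕ → Type u) : ℕ → Type u
  | 0 => PEmpty
  | n + 1 => I n

instance (I : ℕ → Type u) [∀ n, Fintype (I n)] : ∀ n, Fintype (Shift I n)
  | 0 => inferInstanceAs (Fintype PEmpty)
  | n + 1 => inferInstanceAs (Fintype (I n))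

/-- Three columns `A`, `B`, `C` of row vectors over `R`, with internal differentials `dA`, `dB`,
`dC`, maps `f : B → A` and `g : C → B` between neighbouring columns and `h : C → A` raising the
internal degree by one. The relations say that `total` below is a complex; they are Wall's
conditions for assembling resolutions for the stabilizers of the cells of a two-dimensional complex
into a resolution for the whole group. -/
structure ThreeColumns (R : Type*) [Ring R] (α β γ : ℕ → Type u) [∀ n, Fintype (α n)]
    [∀ n, Fintype (β n)] [∀ n, Fintype (γ n)] where
  dA : ∀ n, Matrix (α (n + 1)) (α n) R
  dB : ∀ n, Matrix (β (n + 1)) (β n) R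
  dC : ∀ n, Matrix (γ (n + 1)) (γ n) R
  f : ∀ n, Matrix (β n) (α n) R
  g : ∀ n, Matrix (γ n) (β n) R
  h : ∀ n, Matrix (γ n) (α (n + 1)) R
  dA_mul : ∀ n, dA (n + 1) * dA n = 0
  dB_mul : ∀ n, dB (n + 1) * dB n = 0
  dC_mul : ∀ n, dC (n + 1) * dC n = 0
  f_mul : ∀ n, f (n + 1) * dA n + dB n * f n = 0
  g_mul : ∀ n, g (n + 1) * dB n + dC n * g n = 0
  h_zero_mul : h 0 * dA 0 + g 0 * f 0 = 0
  h_succ_mul : ∀ n, h (n + 1) * dA (n + 1) + g (n + 1) * f (n + 1) + dC n * h n = 0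

namespace ThreeColumns

variable {R : Type*} [Ring R] {α β γ : ℕ → Type u} [∀ n, Fintype (α n)] [∀ n, Fintype (β n)]
  [∀ n, Fintype (γ n)] (T : ThreeColumns R α β γ)

/-- `dB` in total degree. -/
def dBShift : ∀ n, Matrix (Shift β (n + 1)) (Shift β n) R
  | 0 => 0
  | n + 1 => T.dB n

/-- `dC` in total degree. -/
def dCShift : ∀ n, Matrix (Shift (Shift γ) (n + 1)) (Shift (Shift γ) n) R
  | 0 => 0
  | 1 => 0
  | n + 2 => T.dC n

/-- `g` in total degree. -/
def gShift : ∀ n, Matrix (Shift (Shift γ) (n + 1)) (Shift β n) R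
  | 0 => 0
  | n + 1 => T.g n

/-- `h` in total degree. -/
def hShift : ∀ n, Matrix (Shift (Shift γ) (n + 1)) (α n) R
  | 0 => 0
  | n + 1 => T.h n

/-- The component `f` in total degree. -/
def fShift (n : ℕ) : Matrix (Shift β (n + 1)) (α n) R := T.f n

/-- The differential of the total complex of the three columns. -/
def total (n : ℕ) : Matrix (α (n + 1) ⊕ Shift β (n + 1) ⊕ Shift (Shift γ) (n + 1))
    (α n ⊕ Shift β n ⊕ Shift (Shift γ) n) R :=
  fromBlocks (T.dA n) 0 (fromRows (T.fShift n) (T.hShift n))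
    (fromBlocks (T.dBShift n) 0 (T.gShift n) (T.dCShift n))

lemma dBShift_mul : ∀ n, T.dBShift (n + 1) * T.dBShift n = 0
  | 0 => funext₂ fun _ j => PEmpty.elim j
  | n + 1 => T.dB_mul n

lemma dCShift_mul : ∀ n, T.dCShift (n + 1) * T.dCShift n = 0
  | 0 => funext₂ fun _ j => PEmpty.elim j
  | 1 => funext₂ fun _ j => PEmpty.elim j
  | n + 2 => T.dC_mul n

lemma fShift_mul (n : ℕ) : T.fShift (n + 1) * T.dA n + T.dBShift (n + 1) * T.fShift n = 0 :=
  T.f_mul n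

lemma gShift_mul : ∀ n, T.gShift (n + 1) * T.dBShift n + T.dCShift (n + 1) * T.gShift n = 0
  | 0 => funext₂ fun _ j => PEmpty.elim j
  | n + 1 => T.g_mul n

lemma hShift_mul : ∀ n, T.hShift (n + 1) * T.dA n + T.gShift (n + 1) * T.fShift n +
    T.dCShift (n + 1) * T.hShift n = 0
  | 0 => by
    rw [dCShift, Matrix.zero_mul, add_zero]
    exact T.h_zero_mul
  | n + 1 => T.h_succ_mul n

lemma total_mul (n : ℕ) : T.total (n + 1) * T.total n = 0 := by
  have hrow : fromRows (T.fShift (n + 1)) (T.hShift (n + 1)) * T.dA n +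
      fromBlocks (T.dBShift (n + 1)) 0 (T.gShift (n + 1)) (T.dCShift (n + 1)) *
        fromRows (T.fShift n) (T.hShift n) = 0 := by
    rw [fromRows_mul, fromBlocks_mul_fromRows, Matrix.zero_mul, add_zero]
    ext (i | i) j
    · exact congrFun₂ (T.fShift_mul n) i j
    · exact congrFun₂ ((add_assoc _ _ _).symm.trans (T.hShift_mul n)) i j
  rw [total, total, fromBlocks_multiply, fromBlocks_multiply, hrow]
  simp [T.dA_mul, T.dBShift_mul, T.gShift_mul, T.dCShift_mul]

lemma sumElim_vecMul_total (n : ℕ) (a : α (n + 1) → R) (b : Shift β (n + 1) → R)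
    (c : Shift (Shift γ) (n + 1) → R) :
    Sum.elim a (Sum.elim b c) ᵥ* T.total n =
      Sum.elim (a ᵥ* T.dA n + b ᵥ* T.fShift n + c ᵥ* T.hShift n)
        (Sum.elim (b ᵥ* T.dBShift n + c ᵥ* T.gShift n) (c ᵥ* T.dCShift n)) := by
  rw [total, vecMul_fromBlocks, vecMul_fromBlocks, vecMul_fromRows]
  simp [add_assoc]

/-- The columns are exact in positive degrees, and the complex formed by their homology in degree
zero is exact except at `A`. -/
structure IsExact : Prop where
  dA : ∀ n a, a ᵥ* T.dA n = 0 → ∃ a', a' ᵥ* T.dA (n + 1) = a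
  dB : ∀ n b, b ᵥ* T.dB n = 0 → ∃ b', b' ᵥ* T.dB (n + 1) = b
  dC : ∀ n c, c ᵥ* T.dC n = 0 → ∃ c', c' ᵥ* T.dC (n + 1) = c
  f : ∀ a b, a ᵥ* T.dA 0 + b ᵥ* T.f 0 = 0 → ∃ b' c, b' ᵥ* T.dB 0 + c ᵥ* T.g 0 = b
  g : ∀ b c, b ᵥ* T.dB 0 + c ᵥ* T.g 0 = 0 → ∃ c', c' ᵥ* T.dC 0 = c

namespace IsExact

variable {T} (hT : T.IsExact)
include hT

lemma exists_vecMul_dCShift : ∀ (n : ℕ) (b : Shift β (n + 1) → R) (c : Shift (Shift γ) (n + 1) → R),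
    b ᵥ* T.dBShift n + c ᵥ* T.gShift n = 0 → c ᵥ* T.dCShift n = 0 →
    ∃ c', c' ᵥ* T.dCShift (n + 1) = c
  | 0, _, _, _, _ => ⟨0, funext fun i => PEmpty.elim i⟩
  | 1, b, c, hbc, _ => hT.g b c hbc
  | n + 2, _, c, _, hc => hT.dC n c hc

lemma exists_vecMul_dBShift : ∀ (n : ℕ) (a : α (n + 1) → R) (b : Shift β (n + 1) → R),
    a ᵥ* T.dA n + b ᵥ* T.fShift n = 0 → b ᵥ* T.dBShift n = 0 →
    ∃ b' c, b' ᵥ* T.dBShift (n + 1) + c ᵥ* T.gShift (n + 1) = b ∧ c ᵥ* T.dCShift (n + 1) = 0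
  | 0, a, b, hab, _ => by
    obtain ⟨b', c, hb⟩ := hT.f a b hab
    exact ⟨b', c, hb, funext fun i => PEmpty.elim i⟩
  | n + 1, _, b, _, hb => by
    obtain ⟨b', hb'⟩ := hT.dB n b hb
    refine ⟨b', 0, ?_, zero_vecMul _⟩
    rw [zero_vecMul, add_zero]
    exact hb'

/-- The components of a cycle are made boundaries one column at a time, starting with `C`. -/
lemma exists_vecMul_total (n : ℕ) (x : α (n + 1) ⊕ Shift β (n + 1) ⊕ Shift (Shift γ) (n + 1) → R)
    (hx : x ᵥ* T.total n = 0) : ∃ y, y ᵥ* T.total (n + 1) = x := by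
  obtain ⟨a, y, rfl⟩ : ∃ a y, x = Sum.elim a y := ⟨_, _, (Sum.elim_comp_inl_inr x).symm⟩
  obtain ⟨b, c, rfl⟩ : ∃ b c, y = Sum.elim b c := ⟨_, _, (Sum.elim_comp_inl_inr y).symm⟩
  rw [sumElim_vecMul_total, ← Sum.elim_zero_zero, ← Sum.elim_zero_zero] at hx
  obtain ⟨ha, hbc⟩ := Sum.elim_eq_iff.mp hx
  obtain ⟨hb, hc⟩ := Sum.elim_eq_iff.mp hbc
  have hf := fun v => congrArg (v ᵥ* ·) (T.fShift_mul n)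
  have hg := fun v => congrArg (v ᵥ* ·) (T.gShift_mul n)
  have hh := fun v => congrArg (v ᵥ* ·) (T.hShift_mul n)
  simp only [vecMul_add, ← vecMul_vecMul, vecMul_zero] at hf hg hh
  obtain ⟨c₁, rfl⟩ := hT.exists_vecMul_dCShift n b c hb hc
  obtain ⟨b₂, c₂, hb₂, hc₂⟩ := hT.exists_vecMul_dBShift n (a - c₁ ᵥ* T.hShift (n + 1))
    (b - c₁ ᵥ* T.gShift (n + 1))
    (by rw [sub_vecMul, sub_vecMul]; linear_combination (norm := module) ha - hh c₁)
    (by rw [sub_vecMul]; linear_combination (norm := module) hb - hg c₁)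
  obtain ⟨a₃, ha₃⟩ := hT.dA n
    (a - c₁ ᵥ* T.hShift (n + 1) - b₂ ᵥ* T.fShift (n + 1) - c₂ ᵥ* T.hShift (n + 1)) (by
      have hbf := congrArg (· ᵥ* T.fShift n) hb₂
      have hch := congrArg (· ᵥ* T.hShift n) hc₂
      simp only [add_vecMul, sub_vecMul, zero_vecMul] at hbf hch ⊢
      linear_combination (norm := module) ha - hh c₁ - hf b₂ - hh c₂ + hbf + hch)
  refine ⟨Sum.elim a₃ (Sum.elim b₂ (c₁ + c₂)), ?_⟩
  rw [sumElim_vecMul_total]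
  congr 1
  · rw [ha₃, add_vecMul]
    abel
  congr 1
  · rw [add_vecMul]
    linear_combination (norm := module) hb₂
  · rw [add_vecMul, hc₂, add_zero]

end IsExact

section Augmentation

variable {k : Type*} [Field k] (φ : R →+* k)

lemma rank_fromBlocks_zero_fromRows_zero {a a' b b' c c' : Type*} [Fintype a] [Finite a']
    [Fintype b] [Finite b'] [Fintype c] [Finite c'] (E : Matrix b' a k) :
    (fromBlocks (0 : Matrix a' a k) (0 : Matrix a' (b ⊕ c) k)
      (fromRows E (0 : Matrix c' a k)) 0).rank = E.rank := by
  classical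
  cases nonempty_fintype a'
  cases nonempty_fintype b'
  cases nonempty_fintype c'
  apply le_antisymm
  · have hfactor : fromBlocks (0 : Matrix a' a k) (0 : Matrix a' (b ⊕ c) k)
        (fromRows E (0 : Matrix c' a k)) 0 = fromRows (0 : Matrix a' b' k) (fromRows 1 0) *
          (E * fromCols (1 : Matrix a a k) (0 : Matrix a (b ⊕ c) k)) := by
      rw [mul_fromCols, fromRows_mul_fromCols]
      simp
    rw [hfactor]
    exact (rank_mul_le_right _ _).trans (rank_mul_le_left _ _)
  · exact rank_submatrix_le (fromBlocks (0 : Matrix a' a k) (0 : Matrix a' (b ⊕ c) k)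
      (fromRows E (0 : Matrix c' a k)) 0) (Sum.inr ∘ Sum.inl) Sum.inl

lemma rank_map_total (hA : ∀ n, (T.dA n).map φ = 0) (hB : ∀ n, (T.dB n).map φ = 0)
    (hC : ∀ n, (T.dC n).map φ = 0) (hg : ∀ n, (T.g n).map φ = 0) (hh : ∀ n, (T.h n).map φ = 0)
    (n : ℕ) : ((T.total n).map φ).rank = ((T.f n).map φ).rank := by
  have hB' : (T.dBShift n).map φ = 0 := by
    cases n with
    | zero => exact funext₂ fun _ j => PEmpty.elim j
    | succ n => exact hB n
  have hC' : (T.dCShift n).map φ = 0 := by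
    rcases n with _ | _ | n
    · exact funext₂ fun _ j => PEmpty.elim j
    · exact funext₂ fun _ j => PEmpty.elim j
    · exact hC n
  have hg' : (T.gShift n).map φ = 0 := by
    cases n with
    | zero => exact funext₂ fun _ j => PEmpty.elim j
    | succ n => exact hg n
  have hh' : (T.hShift n).map φ = 0 := by
    cases n with
    | zero => exact funext₂ fun i _ => PEmpty.elim i
    | succ n => exact hh n
  have hrows : (fromRows (T.fShift n) (T.hShift n)).map φ =
      fromRows ((T.fShift n).map φ) ((T.hShift n).map φ) := by
    ext (i | i) j <;> rfl
  rw [total, fromBlocks_map, fromBlocks_map, hrows, hA, hB', hC', hg', hh',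
    Matrix.map_zero _ (map_zero _), Matrix.map_zero _ (map_zero _), fromBlocks_zero]
  exact rank_fromBlocks_zero_fromRows_zero _

end Augmentation

end ThreeColumns

section GroupRing

variable {k G : Type u} [CommRing k] [Group G] {α β γ : ℕ → Type u} [∀ n, Fintype (α n)]
  [∀ n, Fintype (β n)] [∀ n, Fintype (γ n)] {T : ThreeColumns k[G] α β γ}

/-- `hzero` is exactness at `A` of the complex of the homology groups of the columns in degree
zero, augmented to `k`. -/
lemma isResolution_total [Nonempty (α 0)] (hT : T.IsExact)
    (hA : ∀ i, ∑ j, aug k G (T.dA 0 i j) = 0) (hf : ∀ i, ∑ j, aug k G (T.f 0 i j) = 0)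
    (hzero : ∀ a : α 0 → k[G], ∑ i, aug k G (a i) = 0 →
      ∃ a' b, a' ᵥ* T.dA 0 + b ᵥ* T.f 0 = a) :
    IsResolution k G (fun n => α n ⊕ Shift β n ⊕ Shift (Shift γ) n) T.total where
  nonempty := inferInstance
  mul_eq_zero := T.total_mul
  aug_eq_zero i := by
    rw [Fintype.sum_sum_type, Finset.sum_eq_zero (f := fun j => aug k G (T.total 0 i (Sum.inr j)))
      (by rintro (j | j) <;> exact PEmpty.elim j), add_zero]
    rcases i with i | i | i
    · exact hA i
    · exact hf i
    · exact PEmpty.elim i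
  exact_zero x hx := by
    rw [Fintype.sum_sum_type, Finset.sum_eq_zero (f := fun j => aug k G (x (Sum.inr j)))
      (by rintro (j | j) <;> exact PEmpty.elim j), add_zero] at hx
    obtain ⟨a', b, hab⟩ := hzero _ hx
    refine ⟨Sum.elim a' (Sum.elim b 0), (T.sumElim_vecMul_total 0 a' b 0).trans ?_⟩
    rw [zero_vecMul, add_zero]
    funext i
    rcases i with i | i | i
    · exact congrFun hab i
    all_goals exact PEmpty.elim i
  exact_succ := hT.exists_vecMul_total

end GroupRing

end MatrixResolution

namespace GroupRing

open MonoidAlgebra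

section Basis

variable {G : Type*}

/-- The basis element of `𝔽₂[G]` given by `g`. -/
def el (g : G) : (ZMod 2)[G] := single g 1

/-- The pairing of an element of `𝔽₂[G]` with a function on `G`. -/
def pairing (f : G → ZMod 2) : (ZMod 2)[G] →+ ZMod 2 :=
  (Finsupp.liftAddHom fun g => (AddMonoidHom.mulRight (f g))).comp
    (coeffAddEquiv (R := ZMod 2) (M := G)).toAddMonoidHom

@[simp] lemma pairing_el (f : G → ZMod 2) (g : G) : pairing f (el g) = f g := by
  simp [pairing, el]

lemma pairing_eq_sum (f : G → ZMod 2) (x : (ZMod 2)[G]) :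
    pairing f x = x.coeff.sum fun g r => r * f g := rfl

@[simp] lemma pairing_zero_left (x : (ZMod 2)[G]) : pairing (fun _ => 0) x = 0 := by
  simp [pairing_eq_sum]

open Classical in
/-- The indicator function of a proposition, with values in `𝔽₂`. -/
def ind (p : Prop) : ZMod 2 := if p then 1 else 0

lemma ind_congr {p q : Prop} (h : p ↔ q) : ind p = ind q := by rw [propext h]

lemma ind_add_self {p q : Prop} (h : p ↔ q) : ind p + ind q = 0 := by
  rw [ind_congr h, CharTwo.add_self_eq_zero]

lemma ind_true {p : Prop} (h : p) : ind p = 1 := if_pos h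

lemma ind_false {p : Prop} (h : ¬ p) : ind p = 0 := if_neg h

lemma coeff_el (g γ : G) : (el g).coeff γ = ind (g = γ) := by
  classical
  rw [el, coeff_single, Finsupp.single_apply, ind]

lemma induction_el {p : (ZMod 2)[G] → Prop} (x : (ZMod 2)[G]) (zero : p 0)
    (add : ∀ x y, p x → p y → p (x + y)) (el : ∀ g, p (el g)) : p x := by
  induction x using MonoidAlgebra.induction_linear with
  | zero => exact zero
  | add x y hx hy => exact add x y hx hy
  | single g r =>
    obtain rfl | rfl : r = 0 ∨ r = 1 := by revert r; decide
    · simpa using zero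
    · exact el g

lemma pairing_add_left (f f' : G → ZMod 2) (x : (ZMod 2)[G]) :
    pairing (fun g => f g + f' g) x = pairing f x + pairing f' x := by
  induction x using induction_el with
  | zero => simp
  | add x y hx hy => rw [map_add, map_add, map_add, hx, hy]; abel
  | el h => simp

end Basis

variable {G : Type*} [Group G]

lemma el_one : el (1 : G) = 1 := rfl

lemma el_mul (g h : G) : el (g * h) = el g * el h := by simp [el, single_mul_single]

lemma el_pow (g : G) (n : ℕ) : el (g ^ n) = el g ^ n := by simp [el, single_pow]

instance : CharP (ZMod 2)[G] 2 := charP_of_injective_algebraMap (algebraMap (ZMod 2) _).injective 2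

lemma pairing_mul_el (f : G → ZMod 2) (x : (ZMod 2)[G]) (g : G) :
    pairing f (x * el g) = pairing (fun h => f (h * g)) x := by
  induction x using induction_el with
  | zero => simp
  | add x y hx hy => rw [add_mul, map_add, map_add, hx, hy]
  | el h => rw [← el_mul, pairing_el, pairing_el]

lemma pairing_mul_one_add {f f' : G → ZMod 2} {g : G} (h : ∀ γ, f γ + f (γ * g) = f' γ)
    (x : (ZMod 2)[G]) : pairing f (x * (1 + el g)) = pairing f' x := by
  rw [mul_add, mul_one, map_add, pairing_mul_el, ← pairing_add_left, funext h]

lemma coeff_mul (x y : (ZMod 2)[G]) (γ : G) :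
    (x * y).coeff γ = pairing (fun g => y.coeff (g⁻¹ * γ)) x := by
  induction x using induction_el with
  | zero => simp
  | add x x' hx hx' => rw [add_mul, map_add, coeff_add, Finsupp.add_apply, hx, hx']
  | el h => rw [pairing_el, el, coeff_single_mul_apply, one_mul]

/-- The group elements congruent to `1` modulo a left ideal. -/
def congrOne (J : Ideal (ZMod 2)[G]) : Subgroup G where
  carrier := {g | 1 + el g ∈ J}
  one_mem' := by
    change 1 + el 1 ∈ J
    rw [el_one, CharTwo.add_self_eq_zero]
    exact J.zero_mem
  mul_mem' {g h} hg hh := by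
    change 1 + el (g * h) ∈ J
    have : 1 + el (g * h) = (1 + el g) + el g * (1 + el h) := by
      rw [mul_add, mul_one, el_mul, add_assoc, ← add_assoc (el g), CharTwo.add_self_eq_zero,
        zero_add]
    rw [this]
    exact J.add_mem hg (J.mul_mem_left _ hh)
  inv_mem' {g} hg := by
    change 1 + el g⁻¹ ∈ J
    have : 1 + el g⁻¹ = el g⁻¹ * (1 + el g) := by
      rw [mul_add, mul_one, ← el_mul, inv_mul_cancel, el_one, add_comm]
    rw [this]
    exact J.mul_mem_left _ hg

lemma mem_congrOne {J : Ideal (ZMod 2)[G]} {g : G} : g ∈ congrOne J ↔ 1 + el g ∈ J := Iff.rfl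

/-- The group elements fixing `x` by right multiplication. -/
def rightStabilizer (x : (ZMod 2)[G]) : Subgroup G where
  carrier := {g | x * el g = x}
  one_mem' := by
    change x * el 1 = x
    rw [el_one, mul_one]
  mul_mem' {g h} hg hh := by
    change x * el (g * h) = x
    rw [el_mul, ← mul_assoc, hg, hh]
  inv_mem' {g} hg := by
    change x * el g⁻¹ = x
    conv_lhs => rw [← show x * el g = x from hg, mul_assoc, ← el_mul, mul_inv_cancel,
      el_one, mul_one]

lemma mem_rightStabilizer_iff {x : (ZMod 2)[G]} {g : G} :
    g ∈ rightStabilizer x ↔ x * (1 + el g) = 0 := by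
  rw [mul_add, mul_one, CharTwo.add_eq_zero]
  exact eq_comm

/-- The sum of the elements of a finite subgroup. -/
def normElement (L : Subgroup G) [Fintype L] : (ZMod 2)[G] := ∑ l : L, el (l : G)

lemma coeff_normElement (L : Subgroup G) [Fintype L] (γ : G) :
    (normElement L).coeff γ = ind (γ ∈ L) := by
  rw [normElement, coeff_sum, Finsupp.finsetSum_apply]
  simp only [coeff_el]
  by_cases hγ : γ ∈ L
  · rw [ind_true hγ, Finset.sum_eq_single ⟨γ, hγ⟩ _ (by simp), ind_true rfl]
    exact fun l _ hl => ind_false fun h => hl (Subtype.ext h)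
  · rw [ind_false hγ]
    exact Finset.sum_eq_zero fun l _ => ind_false fun (h : (l : G) = γ) => hγ (h ▸ l.2)

lemma coeff_mul_normElement (x : (ZMod 2)[G]) (L : Subgroup G) [Fintype L] (γ : G) :
    (x * normElement L).coeff γ = pairing (fun g => ind (g⁻¹ * γ ∈ L)) x := by
  simp only [coeff_mul, coeff_normElement]

/-- A fixed representative of the left coset `g L`. -/
def cosetRep (L : Subgroup G) (g : G) : G := (g : G ⧸ L).out

lemma cosetRep_inv_mul_mem (L : Subgroup G) (g : G) : (cosetRep L g)⁻¹ * g ∈ L :=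
  QuotientGroup.eq.1 (QuotientGroup.out_eq' _)

lemma cosetRep_eq_cosetRep_iff {L : Subgroup G} {g h : G} :
    cosetRep L g = cosetRep L h ↔ g⁻¹ * h ∈ L := by
  rw [cosetRep, cosetRep, Quotient.out_inj, QuotientGroup.eq]

lemma cosetRep_cosetRep (L : Subgroup G) (g : G) : cosetRep L (cosetRep L g) = cosetRep L g :=
  cosetRep_eq_cosetRep_iff.2 (cosetRep_inv_mul_mem L g)

lemma add_mapDomain_cosetRep_mem {L : Subgroup G} {J : Ideal (ZMod 2)[G]}
    (hJ : L ≤ congrOne J) (x : (ZMod 2)[G]) : x + mapDomain (cosetRep L) x ∈ J := by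
  induction x using induction_el with
  | zero => simp
  | add x y hx hy =>
    rw [mapDomain_add, add_add_add_comm]
    exact J.add_mem hx hy
  | el h =>
    have factor : el h + el (cosetRep L h)
        = el (cosetRep L h) * (1 + el ((cosetRep L h)⁻¹ * h)) := by
      rw [mul_add, mul_one, ← el_mul, mul_inv_cancel_left, add_comm]
    rw [el, mapDomain_single]
    exact factor ▸ J.mul_mem_left _ (hJ (cosetRep_inv_mul_mem L h))

lemma mapDomain_cosetRep_eq_zero {L : Subgroup G} {x : (ZMod 2)[G]}
    (hx : ∀ γ, pairing (fun g => ind (γ⁻¹ * g ∈ L)) x = 0) : mapDomain (cosetRep L) x = 0 := by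
  have coeff_mapDomain : ∀ γ,
      (mapDomain (cosetRep L) x).coeff γ = pairing (fun g => ind (cosetRep L g = γ)) x := by
    intro γ
    clear hx
    induction x using induction_el with
    | zero => simp
    | add x y hx hy => rw [mapDomain_add, coeff_add, Finsupp.add_apply, hx, hy, map_add]
    | el h => rw [el, mapDomain_single, ← el, ← el, coeff_el, pairing_el]
  ext γ
  rw [coeff_mapDomain, coeff_zero, Finsupp.zero_apply]
  by_cases hγ : cosetRep L γ = γ
  · rw [← hx γ]
    congr 2
    funext g
    exact ind_congr <| by rw [← cosetRep_eq_cosetRep_iff, hγ, eq_comm]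
  · have never : ∀ g, cosetRep L g ≠ γ := fun g hg => hγ (hg ▸ cosetRep_cosetRep L g)
    simp [ind, never]

lemma mem_of_pairing_coset {L : Subgroup G} {J : Ideal (ZMod 2)[G]}
    (hJ : L ≤ congrOne J) {x : (ZMod 2)[G]}
    (hx : ∀ γ, pairing (fun g => ind (γ⁻¹ * g ∈ L)) x = 0) : x ∈ J := by
  simpa [mapDomain_cosetRep_eq_zero hx] using add_mapDomain_cosetRep_mem hJ x

lemma mem_of_mul_normElement_eq_zero {L : Subgroup G} [Fintype L] {J : Ideal (ZMod 2)[G]}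
    (hJ : L ≤ congrOne J) {x : (ZMod 2)[G]} (hx : x * normElement L = 0) : x ∈ J := by
  refine mem_of_pairing_coset hJ fun γ => ?_
  rw [← Finsupp.zero_apply (M := ZMod 2) (a := γ), ← coeff_zero, ← hx, coeff_mul_normElement]
  congr 2
  funext g
  rw [← inv_mem_iff (H := L), mul_inv_rev, inv_inv]

lemma exists_mul_normElement_eq {L : Subgroup G} [Fintype L] {x : (ZMod 2)[G]}
    (hx : L ≤ rightStabilizer x) : ∃ y, y * normElement L = x := by
  classical
  have coeff_mul_mem : ∀ γ, ∀ l ∈ L, x.coeff (γ * l) = x.coeff γ := fun γ l hl => by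
    conv_lhs => rw [← show x * el l = x from hx hl, el, coeff_mul_single_apply,
      mul_inv_cancel_right, mul_one]
  refine ⟨ofCoeff (x.coeff.filter fun g => cosetRep L g = g), ?_⟩
  ext γ
  have mem : γ⁻¹ * cosetRep L γ ∈ L := by
    simpa using inv_mem (cosetRep_inv_mul_mem L γ)
  rw [coeff_mul_normElement, pairing_eq_sum, coeff_ofCoeff,
    Finsupp.sum_eq_single (cosetRep L γ)]
  · rw [Finsupp.filter_apply_pos (fun g => cosetRep L g = g) _ (cosetRep_cosetRep L γ),
      ind_true (cosetRep_inv_mul_mem L γ), mul_one, ← coeff_mul_mem γ _ mem, mul_inv_cancel_left]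
  · intro g hg hne
    by_cases h : g⁻¹ * γ ∈ L
    · have : cosetRep L g = g := by_contra fun h => hg (Finsupp.filter_apply_neg _ _ h)
      exact absurd (this ▸ cosetRep_eq_cosetRep_iff.2 h) hne
    · rw [ind_false h, mul_zero]
  · simp

lemma normElement_zpowers {g : G} (hg : IsOfFinOrder g) [Fintype (Subgroup.zpowers g)] :
    normElement (Subgroup.zpowers g) = ∑ m ∈ Finset.range (orderOf g), el g ^ m := by
  rw [normElement, ← (finEquivZPowers hg).sum_comp,
    ← Fin.sum_univ_eq_sum_range (fun m => el g ^ m)]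
  simp only [finEquivZPowers_apply, el_pow]

lemma exists_mul_one_add_el {g : G} (hg : orderOf g = 2) {x : (ZMod 2)[G]}
    (hx : x * (1 + el g) = 0) : ∃ y, y * (1 + el g) = x := by
  have finite : IsOfFinOrder g := orderOf_pos_iff.1 (by lia)
  have : Fintype (Subgroup.zpowers g) := Fintype.ofEquiv _ (finEquivZPowers finite)
  have normElement_eq : normElement (Subgroup.zpowers g) = 1 + el g := by
    rw [normElement_zpowers finite, hg, Finset.sum_range_succ, Finset.sum_range_one, pow_zero,
      pow_one]
  rw [← normElement_eq]
  exact exists_mul_normElement_eq (Subgroup.zpowers_le.2 (mem_rightStabilizer_iff.2 hx))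

end GroupRing

/-- A pair of elements of a ring satisfying the relations of the elements `i` and `j` of the
quaternion group of order eight. -/
structure QuaternionPair (R : Type*) [Ring R] where
  i : R
  j : R
  i_pow_four : i * (i * (i * i)) = 1
  j_mul_j : j * j = i * i
  j_mul_i : j * i = i * (i * (i * j))

namespace QuaternionPair

open Matrix

variable {R : Type*} [Ring R]

/-- The ranks of the periodic free resolution of the quaternion group. -/
abbrev rk : ℕ → ℕ
  | 0 => 1
  | 1 => 2
  | 2 => 2
  | 3 => 1
  | n + 4 => rk n

/-- The differential of the periodic free resolution of a cyclic group of order four with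
generator `g`. -/
def dCyclic (g : R) : ℕ → R
  | 0 => 1 + g
  | 1 => 1 + g + g * g + g * (g * g)
  | n + 2 => dCyclic g n

/-- The chain map to `dCyclic g` from the resolution of the subgroup of order two, whose
differential is `1 + g * g` in all degrees. -/
def mu (g : R) : ℕ → R
  | 0 => 1
  | 1 => 1 + g
  | n + 2 => mu g n

variable (Q : QuaternionPair R)

/-- The element `k = i j`. -/
def k : R := Q.i * Q.j

/-- The central element `-1` of the quaternion group. -/
def z : R := Q.i * Q.i

/-- The sum of the eight elements of the quaternion group. -/
def norm : R := dCyclic Q.i 1 * (1 + Q.j)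

/-- The differential of the periodic free resolution of the quaternion group. -/
def dQuat : ∀ n, Matrix (Fin (rk (n + 1))) (Fin (rk n)) R
  | 0 => !![1 + Q.i; 1 + Q.j]
  | 1 => !![1 + Q.i, 1 + Q.j; 1 + Q.k, 1 + Q.i]
  | 2 => !![1 + Q.i, 1 + Q.k]
  | 3 => !![Q.norm]
  | n + 4 => dQuat n

/-- The chain map from the resolution of `⟨i⟩` to the one of the quaternion group. -/
def phiI : ∀ n, Fin (rk n) → R
  | 0 => ![1]
  | 1 => ![1, 0]
  | 2 => ![1 + Q.j, Q.z + Q.z * Q.i]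
  | 3 => ![1 + Q.k]
  | n + 4 => phiI n

/-- The chain map from the resolution of `⟨j⟩` to the one of the quaternion group. -/
def phiJ : ∀ n, Fin (rk n) → R
  | 0 => ![1]
  | 1 => ![0, 1]
  | 2 => ![1 + Q.z * Q.j, 1 + Q.i]
  | 3 => ![Q.j + Q.z * Q.k]
  | n + 4 => phiJ n

/-- The chain map from the resolution of `⟨k⟩` to the one of the quaternion group. -/
def phiK : ∀ n, Fin (rk n) → R
  | 0 => ![1]
  | 1 => ![Q.k, 1]
  | 2 => ![1 + Q.k, Q.j + Q.z]
  | 3 => ![Q.z + Q.z * Q.i]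
  | n + 4 => phiK n

/-- A homotopy between the chain maps through `⟨i⟩` and `⟨j⟩`. -/
def homIJ : ∀ n, Fin (rk (n + 1)) → R
  | 0 => 0
  | 1 => ![1, 0]
  | 2 => ![1 + Q.i + Q.k + Q.z * Q.j]
  | 3 => 0
  | n + 4 => homIJ n

/-- A homotopy between the chain maps through `⟨i⟩` and `⟨k⟩`. -/
def homIK : ∀ n, Fin (rk (n + 1)) → R
  | 0 => 0
  | 1 => ![Q.i, 1]
  | 2 => ![1 + Q.k + Q.z * Q.i]
  | 3 => 0
  | n + 4 => homIK n

/-- A homotopy between the chain map through `⟨i⟩` and its translate by `j`. -/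
def homJ : ∀ n, Fin (rk (n + 1)) → R
  | 0 => ![0, 1]
  | 1 => ![1 + Q.j, 0]
  | 2 => ![Q.k + Q.z * Q.j]
  | 3 => 0
  | n + 4 => homJ n

section Relations

lemma i_pow_four_mul (x : R) : Q.i * (Q.i * (Q.i * (Q.i * x))) = x := by
  simpa [mul_assoc] using congrArg (· * x) Q.i_pow_four

lemma j_mul_i_mul (x : R) : Q.j * (Q.i * x) = Q.i * (Q.i * (Q.i * (Q.j * x))) := by
  simpa [mul_assoc] using congrArg (· * x) Q.j_mul_i

attribute [simp] i_pow_four j_mul_j j_mul_i i_pow_four_mul j_mul_i_mul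
attribute [local simp] CharTwo.add_self_eq_zero CharTwo.add_cancel_left
attribute [local simp] mul_add add_mul mul_assoc add_assoc add_comm add_left_comm
attribute [local simp] dCyclic mu norm k z dQuat phiI phiJ phiK homIJ homIK homJ

lemma homJ_zero_vecMul : Q.homJ 0 ᵥ* Q.dQuat 0
    = (1 + Q.j) • mu Q.i 0 • Q.phiI 0 := by simp

variable [CharP R 2]

lemma dCyclic_mul_dCyclic {g : R} (hg : g * (g * (g * g)) = 1) :
    ∀ n, dCyclic g (n + 1) * dCyclic g n = 0
  | 0 => by simp [hg]
  | 1 => by simp [hg]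
  | n + 2 => dCyclic_mul_dCyclic hg n

lemma mu_mul_dCyclic {g : R} (hg : g * (g * (g * g)) = 1) :
    ∀ n, mu g (n + 1) * dCyclic g n = (1 + g * g) * mu g n
  | 0 => by simp
  | 1 => by simp
  | n + 2 => mu_mul_dCyclic hg n

lemma dQuat_mul_dQuat : ∀ n, Q.dQuat (n + 1) * Q.dQuat n = 0
  | 0 => by ext a b; fin_cases a <;> fin_cases b <;> simp [Matrix.mul_apply]
  | 1 => by ext a b; fin_cases a; fin_cases b <;> simp [Matrix.mul_apply]
  | 2 => by ext a b; fin_cases a; fin_cases b <;> simp [Matrix.mul_apply]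
  | 3 => by ext a b; fin_cases a <;> fin_cases b <;> simp [Matrix.mul_apply]
  | n + 4 => dQuat_mul_dQuat n

lemma phiI_succ_vecMul : ∀ n, Q.phiI (n + 1) ᵥ* Q.dQuat n = dCyclic Q.i n • Q.phiI n
  | 0 => by simp
  | 1 => by ext c; fin_cases c <;> simp
  | 2 => by simp
  | 3 => by simp
  | n + 4 => phiI_succ_vecMul n

lemma phiJ_succ_vecMul : ∀ n, Q.phiJ (n + 1) ᵥ* Q.dQuat n = dCyclic Q.j n • Q.phiJ n
  | 0 => by simp
  | 1 => by simp
  | 2 => by simp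
  | 3 => by simp
  | n + 4 => phiJ_succ_vecMul n

lemma phiK_succ_vecMul : ∀ n, Q.phiK (n + 1) ᵥ* Q.dQuat n = dCyclic Q.k n • Q.phiK n
  | 0 => by simp
  | 1 => by simp
  | 2 => by simp
  | 3 => by simp
  | n + 4 => phiK_succ_vecMul n

lemma homIJ_zero_vecMul : Q.homIJ 0 ᵥ* Q.dQuat 0
    = mu Q.i 0 • Q.phiI 0 + mu Q.j 0 • Q.phiJ 0 := by simp

lemma homIJ_succ_vecMul : ∀ n, Q.homIJ (n + 1) ᵥ* Q.dQuat (n + 1) + (1 + Q.z) • Q.homIJ n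
    = mu Q.i (n + 1) • Q.phiI (n + 1) + mu Q.j (n + 1) • Q.phiJ (n + 1)
  | 0 => by simp
  | 1 => by simp
  | 2 => by simp
  | 3 => by simp
  | n + 4 => homIJ_succ_vecMul n

lemma homIK_zero_vecMul : Q.homIK 0 ᵥ* Q.dQuat 0
    = mu Q.i 0 • Q.phiI 0 + mu Q.k 0 • Q.phiK 0 := by simp

lemma homIK_succ_vecMul : ∀ n, Q.homIK (n + 1) ᵥ* Q.dQuat (n + 1) + (1 + Q.z) • Q.homIK n
    = mu Q.i (n + 1) • Q.phiI (n + 1) + mu Q.k (n + 1) • Q.phiK (n + 1)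
  | 0 => by simp
  | 1 => by simp
  | 2 => by simp
  | 3 => by simp
  | n + 4 => homIK_succ_vecMul n

lemma homJ_succ_vecMul : ∀ n, Q.homJ (n + 1) ᵥ* Q.dQuat (n + 1) + (1 + Q.z) • Q.homJ n
    = (1 + Q.j) • mu Q.i (n + 1) • Q.phiI (n + 1)
  | 0 => by ext c; fin_cases c <;> simp
  | 1 => by simp
  | 2 => by simp
  | 3 => by simp
  | n + 4 => homJ_succ_vecMul n

/-- The exactness properties of right multiplication on the group ring of a group in which the
pair generates a quaternion subgroup of order eight, over which that ring is free. -/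
structure IsFree : Prop where
  i : ∀ n x, x * dCyclic Q.i n = 0 → ∃ y, y * dCyclic Q.i (n + 1) = x
  j : ∀ n x, x * dCyclic Q.j n = 0 → ∃ y, y * dCyclic Q.j (n + 1) = x
  of_mul_one_add : ∀ x, x * (1 + Q.i) = 0 → x * (1 + Q.j) = 0 → ∃ y, y * Q.norm = x
  of_mul_norm : ∀ x, x * Q.norm = 0 → ∃ a b, a * (1 + Q.i) + b * (1 + Q.j) = x

/-- The pair `(i, k)`. -/
def rotate : QuaternionPair R where
  i := Q.i
  j := Q.k
  i_pow_four := Q.i_pow_four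
  j_mul_j := by simp
  j_mul_i := by simp

variable {Q}

lemma exists_dQuat_zero (hi : ∀ n x, x * dCyclic Q.i n = 0 → ∃ y, y * dCyclic Q.i (n + 1) = x)
    (hij : ∀ x, x * (1 + Q.i) = 0 → x * (1 + Q.j) = 0 → ∃ y, y * Q.norm = x) {a b : R}
    (h : a * (1 + Q.i) + b * (1 + Q.j) = 0) :
    ∃ c e, c * (1 + Q.i) + e * (1 + Q.k) = a ∧ c * (1 + Q.j) + e * (1 + Q.i) = b := by
  have h' : b * (1 + Q.j) = a * (1 + Q.i) := (CharTwo.add_eq_zero.1 h).symm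
  obtain ⟨c, hc⟩ := hij (b * dCyclic Q.i 1) (by rw [mul_assoc]; simp) (by
    calc b * dCyclic Q.i 1 * (1 + Q.j) = b * (1 + Q.j) * dCyclic Q.i 1 := by simp
      _ = 0 := by rw [h']; simp)
  obtain ⟨e, he⟩ := hi 1 (b + c * (1 + Q.j)) (by
    rw [add_mul, ← hc]; simp)
  have hb : b = c * (1 + Q.j) + e * (1 + Q.i) := by
    change e * (1 + Q.i) = _ at he
    rw [he]; simp
  obtain ⟨f, hf⟩ := hi 0 (a + c * (1 + Q.i) + e * (1 + Q.k)) (by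
    calc (a + c * (1 + Q.i) + e * (1 + Q.k)) * (1 + Q.i)
      _ = a * (1 + Q.i) + (c * (1 + Q.j) + e * (1 + Q.i)) * (1 + Q.j) := by simp
      _ = 0 := by rw [← hb, h])
  refine ⟨c + f * (1 + Q.z * Q.j), e + f * (Q.z * Q.j * (1 + Q.i)), ?_, ?_⟩
  · calc _ = f * dCyclic Q.i 1 + (c * (1 + Q.i) + e * (1 + Q.k)) := by simp
      _ = a := by rw [hf]; simp
  · rw [hb]; simp

lemma IsFree.of_mul_one_add_k (hQ : Q.IsFree) {x : R} (hi : x * (1 + Q.i) = 0)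
    (hk : x * (1 + Q.k) = 0) : ∃ y, y * Q.norm = x := by
  have hxi : x * Q.i = x := (CharTwo.add_eq_zero.1 (by simpa [mul_add] using hi)).symm
  refine hQ.of_mul_one_add x hi ?_
  rw [← hk, mul_add, mul_add, k, ← mul_assoc, hxi]

lemma IsFree.exists_dQuat_one (hQ : Q.IsFree) {u v : R}
    (h₀ : u * (1 + Q.i) + v * (1 + Q.k) = 0) (h₁ : u * (1 + Q.j) + v * (1 + Q.i) = 0) :
    ∃ c, c * (1 + Q.i) = u ∧ c * (1 + Q.k) = v := by
  have norm_rotate : Q.rotate.norm = Q.norm := by simp [rotate]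
  have hik : ∀ x, x * (1 + Q.rotate.i) = 0 → x * (1 + Q.rotate.j) = 0 →
      ∃ y, y * Q.rotate.norm = x := fun x hi hk => norm_rotate ▸ hQ.of_mul_one_add_k hi hk
  obtain ⟨c, e, hu, hv⟩ := exists_dQuat_zero (Q := Q.rotate) hQ.i hik h₀
  have he : e * dCyclic Q.j 1 = 0 := by
    rw [← h₁, ← hu, ← hv]; simp [rotate]
  obtain ⟨e', rfl⟩ := hQ.j 1 e he
  refine ⟨c + e' * (Q.j * (1 + Q.i)), ?_, ?_⟩
  · rw [← hu]; simp [rotate]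
  · rw [← hv]; simp [rotate]

lemma IsFree.exists_vecMul_dQuat (hQ : Q.IsFree) : ∀ n (x : Fin (rk (n + 1)) → R),
    x ᵥ* Q.dQuat n = 0 → ∃ y, y ᵥ* Q.dQuat (n + 1) = x
  | 0, x, h => by
    obtain ⟨c, e, hc, he⟩ := exists_dQuat_zero hQ.i hQ.of_mul_one_add (a := x 0) (b := x 1)
      ((Fin.sum_univ_two fun t => x t * Q.dQuat 0 t 0).symm.trans (congrFun h 0))
    exact ⟨![c, e], by ext t; fin_cases t <;> simp [← hc, ← he]⟩
  | 1, x, h => by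
    obtain ⟨c, hc, he⟩ := hQ.exists_dQuat_one (u := x 0) (v := x 1)
      ((Fin.sum_univ_two fun t => x t * Q.dQuat 1 t 0).symm.trans (congrFun h 0))
      ((Fin.sum_univ_two fun t => x t * Q.dQuat 1 t 1).symm.trans (congrFun h 1))
    exact ⟨![c], by ext t; fin_cases t <;> simp [← hc, ← he]⟩
  | 2, x, h => by
    obtain ⟨y, hy⟩ := hQ.of_mul_one_add_k
      ((Fin.sum_univ_one fun t => x t * Q.dQuat 2 t 0).symm.trans (congrFun h 0))
      ((Fin.sum_univ_one fun t => x t * Q.dQuat 2 t 1).symm.trans (congrFun h 1))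
    exact ⟨![y], by ext t; fin_cases t; simp [← hy]⟩
  | 3, x, h => by
    obtain ⟨a, b, hab⟩ := hQ.of_mul_norm (x 0)
      ((Fin.sum_univ_one fun t => x t * Q.dQuat 3 t 0).symm.trans (congrFun h 0))
    exact ⟨![a, b], by ext t; fin_cases t; simp [← hab]⟩
  | n + 4, x, h => exists_vecMul_dQuat hQ n x h

end Relations

section GroupRing

open GroupRing MonoidAlgebra QuaternionGroup

variable {G : Type*} [Group G] {ψ : QuaternionGroup 2 →* G}

/-- The pair given by the images of `i` and `j` under a homomorphism from the quaternion group. -/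
def ofHom (ψ : QuaternionGroup 2 →* G) : QuaternionPair (ZMod 2)[G] where
  i := el (ψ (a 1))
  j := el (ψ (xa 0))
  i_pow_four := by simp only [← el_mul, ← map_mul]; rw [← el_one, ← map_one ψ]; rfl
  j_mul_j := by simp only [← el_mul, ← map_mul]; rfl
  j_mul_i := by simp only [← el_mul, ← map_mul]; rfl

lemma exists_mul_dCyclic {g : G} (hg : orderOf g = 4) : ∀ n (x : (ZMod 2)[G]),
    x * dCyclic (el g) n = 0 → ∃ y, y * dCyclic (el g) (n + 1) = x := by
  have finite : IsOfFinOrder g := orderOf_pos_iff.1 (by lia)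
  have : Fintype (Subgroup.zpowers g) := Fintype.ofEquiv _ (finEquivZPowers finite)
  have normElement_eq : normElement (Subgroup.zpowers g) = dCyclic (el g) 1 := by
    rw [normElement_zpowers finite, hg]
    simp [Finset.sum_range_succ, dCyclic, pow_succ, mul_assoc]
  intro n
  induction n using Nat.twoStepInduction with
  | zero =>
    intro x hx
    rw [← normElement_eq]
    exact exists_mul_normElement_eq (Subgroup.zpowers_le.2 (mem_rightStabilizer_iff.2 hx))
  | one =>
    intro x hx
    refine Ideal.mem_span_singleton'.1 (mem_of_mul_normElement_eq_zero ?_ (normElement_eq ▸ hx))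
    exact Subgroup.zpowers_le.2 (mem_congrOne.2 (Ideal.mem_span_singleton_self _))
  | more _ ih _ => exact ih

lemma range_le {K : Subgroup G} (hi : ψ (a 1) ∈ K) (hj : ψ (xa 0) ∈ K) : ψ.range ≤ K := by
  have mem_a : ∀ n, ψ (a n) ∈ K := fun n => by
    have : a n = a 1 ^ n.val := by revert n; decide
    rw [this, map_pow]
    exact K.pow_mem hi _
  rintro _ ⟨q | n, rfl⟩
  · exact mem_a q
  · have : xa n = xa 0 * a n := by rw [xa_mul_a, zero_add]
    rw [this, map_mul]
    exact K.mul_mem hj (mem_a n)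

lemma sum_el_eq_norm (ψ : QuaternionGroup 2 →* G) : ∑ q, el (ψ q) = (ofHom ψ).norm := by
  have univ_eq : (Finset.univ : Finset (QuaternionGroup 2)) =
      {1, a 1, a 1 * a 1, a 1 * (a 1 * a 1), xa 0, a 1 * xa 0, a 1 * a 1 * xa 0,
        a 1 * (a 1 * a 1) * xa 0} := by decide
  rw [univ_eq]
  repeat rw [Finset.sum_insert (by decide)]
  simp only [Finset.sum_singleton, map_mul, map_one, el_mul, el_one, norm, dCyclic, ofHom, mul_add,
    add_mul, one_mul, mul_one]
  abel

lemma normElement_range (hψ : Function.Injective ψ) [Fintype ψ.range] :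
    normElement ψ.range = (ofHom ψ).norm := by
  rw [normElement, ← (MonoidHom.ofInjective hψ).toEquiv.sum_comp, ← sum_el_eq_norm]
  rfl

lemma isFree_ofHom (hψ : Function.Injective ψ) : (ofHom ψ).IsFree := by
  have : Fintype ψ.range := Fintype.ofEquiv _ (MonoidHom.ofInjective hψ).toEquiv
  have orderOf_eq : ∀ q, orderOf (ψ q) = orderOf q := orderOf_injective ψ hψ
  refine ⟨exists_mul_dCyclic ?_, exists_mul_dCyclic ?_, fun x hi hj => ?_, fun x hx => ?_⟩
  · rw [orderOf_eq, orderOf_a_one]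
  · rw [orderOf_eq, orderOf_xa]
  · rw [← normElement_range hψ]
    exact exists_mul_normElement_eq
      (range_le (mem_rightStabilizer_iff.2 hi) (mem_rightStabilizer_iff.2 hj))
  · refine Ideal.mem_span_pair.1 (mem_of_mul_normElement_eq_zero ?_ (normElement_range hψ ▸ hx))
    exact range_le (Ideal.subset_span (Set.mem_insert _ _))
      (Ideal.subset_span (Set.mem_insert_of_mem _ rfl))

end GroupRing

end QuaternionPair

namespace BianchiTwo

open Matrix
open Zsqrtd (sqrtd)

section Matrices

/-- The group `SL₂(ℤ[√-2])`, in which `Γ₀(√-2)` is studied. -/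
abbrev SL2 := SpecialLinearGroup (Fin 2) (ℤ√(-2))

/-- The unipotent upper triangular matrix with upper right entry `x`. -/
def upper (x : ℤ√(-2)) : SL2 := ⟨!![1, x; 0, 1], by simp [det_fin_two]⟩

/-- The unipotent lower triangular matrix with lower left entry `x`. -/
def lower (x : ℤ√(-2)) : SL2 := ⟨!![1, 0; x, 1], by simp [det_fin_two]⟩

/-- The rotation `S` of `SL₂(ℤ)`, of order four. It lies outside of `Γ₀(√-2)`, but it preserves
the planes by which the exactness of the edge complex is detected. -/
def matA : SL2 := ⟨!![0, -1; 1, 0], by simp [det_fin_two]⟩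

/-- The translation by `1`, a generator of `Γ₀(√-2)`. -/
def matT : SL2 := upper 1

/-- The translation by `√-2`, a generator of `Γ₀(√-2)`. -/
def matU : SL2 := upper sqrtd

/-- The product `matA * matT`, which conjugates `matA` and `matW` to `matR` and `matI`. -/
def matS : SL2 := ⟨!![0, -1; 1, 1], by simp [det_fin_two]⟩

/-- A generator of order four of `Γ₀(√-2)`, lying in the stabilizer of the first vertex. -/
def matW : SL2 := ⟨!![1, sqrtd; sqrtd, -1], by decide⟩

/-- A generator of order four of `Γ₀(√-2)`, lying in the stabilizers of both vertices. -/
def matI : SL2 := ⟨!![-1 - sqrtd, -sqrtd; 2, 1 + sqrtd], by decide⟩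

/-- A generator of order four of `Γ₀(√-2)`, lying in the stabilizer of the second vertex. -/
def matR : SL2 := ⟨!![-1, -1; 2, 1], by decide⟩

@[simp] lemma coe_upper (x : ℤ√(-2)) : (upper x : Matrix (Fin 2) (Fin 2) _) = !![1, x; 0, 1] := rfl

@[simp] lemma coe_lower (x : ℤ√(-2)) : (lower x : Matrix (Fin 2) (Fin 2) _) = !![1, 0; x, 1] := rfl

@[simp] lemma coe_matA : (matA : Matrix (Fin 2) (Fin 2) (ℤ√(-2))) = !![0, -1; 1, 0] := rfl

@[simp] lemma coe_matT : (matT : Matrix (Fin 2) (Fin 2) (ℤ√(-2))) = !![1, 1; 0, 1] := rfl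

@[simp] lemma coe_matU : (matU : Matrix (Fin 2) (Fin 2) (ℤ√(-2))) = !![1, sqrtd; 0, 1] := rfl

@[simp] lemma coe_matS : (matS : Matrix (Fin 2) (Fin 2) (ℤ√(-2))) = !![0, -1; 1, 1] := rfl

@[simp] lemma coe_matW : (matW : Matrix (Fin 2) (Fin 2) (ℤ√(-2))) = !![1, sqrtd; sqrtd, -1] := rfl

@[simp] lemma coe_matI : (matI : Matrix (Fin 2) (Fin 2) (ℤ√(-2))) =
    !![-1 - sqrtd, -sqrtd; 2, 1 + sqrtd] := rfl

@[simp] lemma coe_matR : (matR : Matrix (Fin 2) (Fin 2) (ℤ√(-2))) = !![-1, -1; 2, 1] := rfl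

lemma matA_mul_matT : matA * matT = matS := by decide

lemma matA_mul_matA : matA * matA = -1 := by decide

lemma matI_mul_matI : matI * matI = -1 := by decide

lemma matW_mul_matW : matW * matW = -1 := by decide

lemma matR_mul_matR : matR * matR = -1 := by decide

lemma matR_mul_matS : matR * matS = matS * matA := by decide

lemma matI_mul_matS : matI * matS = matS * matW := by decide

lemma matT_mul_matU : matT * matU = matU * matT := by decide

lemma matW_mul_matT : matW * matT = matT * (matI * matW) := by decide

lemma matR_mul_matU_mul_matW_mul_matR :
    matR * (matU * matW * matR) = matU * matW * matR * (matI * matR) := by decide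

lemma matR_eq : matR = matS * matA * matS⁻¹ := by rw [← matR_mul_matS, mul_inv_cancel_right]

lemma matI_eq : matI = matS * matW * matS⁻¹ := by rw [← matI_mul_matS, mul_inv_cancel_right]

lemma matT_eq : matT = matA⁻¹ * matS := by rw [← matA_mul_matT, inv_mul_cancel_left]

lemma det_re (g : SL2) : (g 0 0).re * (g 1 1).re - 2 * (g 0 0).im * (g 1 1).im
    - (g 0 1).re * (g 1 0).re + 2 * (g 0 1).im * (g 1 0).im = 1 := by
  have h := congrArg Zsqrtd.re g.2
  simp only [det_fin_two, Zsqrtd.re_sub, Zsqrtd.re_mul, Zsqrtd.re_one] at h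
  linarith

lemma det_im (g : SL2) : (g 0 0).re * (g 1 1).im + (g 0 0).im * (g 1 1).re
    - (g 0 1).re * (g 1 0).im - (g 0 1).im * (g 1 0).re = 0 := by
  have h := congrArg Zsqrtd.im g.2
  simp only [det_fin_two, Zsqrtd.im_sub, Zsqrtd.im_mul, Zsqrtd.im_one] at h
  linarith

lemma mul_apply_two (g h : SL2) (i j : Fin 2) : (g * h) i j = g i 0 * h 0 j + g i 1 * h 1 j := by
  simp [mul_apply, Fin.sum_univ_two]

lemma ext_entries {g h : SL2} (h00 : g 0 0 = h 0 0) (h01 : g 0 1 = h 0 1) (h10 : g 1 0 = h 1 0)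
    (h11 : g 1 1 = h 1 1) : g = h := by
  refine Subtype.ext (Matrix.ext fun i j => ?_)
  fin_cases i <;> fin_cases j <;> assumption

end Matrices

section HermitianForms

/-- The pairing of a hermitian form with the definite form `(2, 1 + √-2; 1 - √-2, 2)`, which is a
point of hyperbolic space. If the form is indefinite it represents a hyperbolic plane, and the sign
of the height tells on which side of the plane the point lies. -/
def height (H : Matrix (Fin 2) (Fin 2) (ℤ√(-2))) : ℤ :=
  (H 0 1).re + 2 * (H 0 1).im - (H 0 0).re - (H 1 1).re

/-- The form `(0, √-2; -√-2, 0)`, transformed by `g`. Before the transformation its plane is the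
one that is preserved by the matrices with real entries. -/
def realForm (g : SL2) : Matrix (Fin 2) (Fin 2) (ℤ√(-2)) :=
  (g.1)ᴴ * !![0, sqrtd; -sqrtd, 0] * g.1

/-- The form `(0, 1; 1, 0)`, transformed by `g`. Before the transformation its plane is the one
above the imaginary axis. -/
def imagForm (g : SL2) : Matrix (Fin 2) (Fin 2) (ℤ√(-2)) :=
  (g.1)ᴴ * !![0, 1; 1, 0] * g.1

lemma realForm_mul (g h : SL2) : realForm (g * h) = (h.1)ᴴ * realForm g * h.1 := by
  simp [realForm, conjTranspose_mul, Matrix.mul_assoc]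

lemma imagForm_mul (g h : SL2) : imagForm (g * h) = (h.1)ᴴ * imagForm g * h.1 := by
  simp [imagForm, conjTranspose_mul, Matrix.mul_assoc]

lemma isHermitian_realForm (g : SL2) : (realForm g).IsHermitian :=
  isHermitian_conjTranspose_mul_mul _ (by decide)

lemma isHermitian_imagForm (g : SL2) : (imagForm g).IsHermitian :=
  isHermitian_conjTranspose_mul_mul _ (by decide)

lemma det_realForm (g : SL2) : (realForm g).det = -2 := by
  rw [realForm, det_mul, det_mul, det_conjTranspose, g.2, det_fin_two]
  decide

lemma det_imagForm (g : SL2) : (imagForm g).det = -1 := by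
  rw [imagForm, det_mul, det_mul, det_conjTranspose, g.2, det_fin_two]
  decide

section IsHermitian

variable {H : Matrix (Fin 2) (Fin 2) (ℤ√(-2))}

lemma im_apply_self_eq_zero (hH : H.IsHermitian) (i : Fin 2) : (H i i).im = 0 := by
  have h := congrArg Zsqrtd.im (hH.apply i i)
  rw [Zsqrtd.im_star] at h
  omega

lemma det_re_of_isHermitian (hH : H.IsHermitian) :
    H.det.re = (H 0 0).re * (H 1 1).re - (H 0 1).re ^ 2 - 2 * (H 0 1).im ^ 2 := by
  rw [det_fin_two, ← hH.apply 1 0]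
  simp [im_apply_self_eq_zero hH]
  ring

lemma height_transform_matW (hH : H.IsHermitian) :
    height ((matW.1)ᴴ * H * matW.1) = height H := by
  simp [height, mul_apply, Fin.sum_univ_two, ← hH.apply 1 0, im_apply_self_eq_zero hH]
  ring

lemma height_transform_matS (hH : H.IsHermitian) :
    height ((matS.1)ᴴ * H * matS.1) = height H := by
  simp [height, mul_apply, Fin.sum_univ_two, ← hH.apply 1 0, im_apply_self_eq_zero hH]
  ring

lemma height_transform_matA (hH : H.IsHermitian) : height ((matA.1)ᴴ * H * matA.1) =
    -(H 0 1).re + 2 * (H 0 1).im - (H 0 0).re - (H 1 1).re := by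
  simp [height, mul_apply, Fin.sum_univ_two, ← hH.apply 1 0]
  ring

lemma height_transform_matU (hH : H.IsHermitian) : height ((matU.1)ᴴ * H * matU.1) =
    (H 0 1).re - 2 * (H 0 1).im - (H 0 0).re - (H 1 1).re := by
  simp [height, mul_apply, Fin.sum_univ_two, ← hH.apply 1 0, im_apply_self_eq_zero hH]
  ring

end IsHermitian

/-- The height of the base point above the translated real plane. -/
def realHeight (g : SL2) : ℤ := height (realForm g)

/-- The height of the base point above the translated imaginary plane. -/
def imagHeight (g : SL2) : ℤ := height (imagForm g)

lemma realHeight_mul_matW (g : SL2) : realHeight (g * matW) = realHeight g := by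
  rw [realHeight, realForm_mul, height_transform_matW (isHermitian_realForm g), realHeight]

lemma realHeight_mul_matS (g : SL2) : realHeight (g * matS) = realHeight g := by
  rw [realHeight, realForm_mul, height_transform_matS (isHermitian_realForm g), realHeight]

lemma imagHeight_mul_matW (g : SL2) : imagHeight (g * matW) = imagHeight g := by
  rw [imagHeight, imagForm_mul, height_transform_matW (isHermitian_imagForm g), imagHeight]

lemma imagHeight_mul_matS (g : SL2) : imagHeight (g * matS) = imagHeight g := by
  rw [imagHeight, imagForm_mul, height_transform_matS (isHermitian_imagForm g), imagHeight]

lemma realForm_apply_eq (g : SL2) : ∃ A u v C : ℤ, (realForm g 0 0).re = 4 * A ∧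
    (realForm g 0 1).re = 4 * u ∧ (realForm g 0 1).im = 1 + 4 * v ∧
    (realForm g 1 1).re = 4 * C := by
  refine ⟨(g 0 0).im * (g 1 0).re - (g 0 0).re * (g 1 0).im,
    (g 0 0).im * (g 1 1).re - (g 1 0).im * (g 0 1).re,
    (g 0 0).im * (g 1 1).im - (g 1 0).im * (g 0 1).im,
    (g 0 1).im * (g 1 1).re - (g 0 1).re * (g 1 1).im, ?_, ?_, ?_, ?_⟩ <;>
    simp [realForm, mul_apply, Fin.sum_univ_two]
  · ring
  · linear_combination -2 * det_im g
  · linear_combination det_re g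
  · ring

lemma imagForm_apply_eq (g : SL2) : ∃ A u v C : ℤ, (imagForm g 0 0).re = 2 * A ∧
    (imagForm g 0 1).re = 1 + 2 * u ∧ (imagForm g 0 1).im = 2 * v ∧
    (imagForm g 1 1).re = 2 * C := by
  refine ⟨(g 0 0).re * (g 1 0).re + 2 * (g 0 0).im * (g 1 0).im,
    (g 0 1).re * (g 1 0).re + 2 * (g 0 0).im * (g 1 1).im,
    (g 1 0).re * (g 0 1).im - (g 0 0).im * (g 1 1).re,
    (g 0 1).re * (g 1 1).re + 2 * (g 0 1).im * (g 1 1).im, ?_, ?_, ?_, ?_⟩ <;>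
    simp [imagForm, mul_apply, Fin.sum_univ_two]
  · ring
  · linear_combination det_re g
  · linear_combination det_im g
  · ring

lemma realForm_discriminant (g : SL2) : (realForm g 0 0).re * (realForm g 1 1).re =
    (realForm g 0 1).re ^ 2 + 2 * (realForm g 0 1).im ^ 2 - 2 := by
  have h := det_re_of_isHermitian (isHermitian_realForm g)
  rw [det_realForm, show (-2 : ℤ√(-2)).re = -2 from rfl] at h
  linarith

lemma imagForm_discriminant (g : SL2) : (imagForm g 0 0).re * (imagForm g 1 1).re =
    (imagForm g 0 1).re ^ 2 + 2 * (imagForm g 0 1).im ^ 2 - 1 := by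
  have h := det_re_of_isHermitian (isHermitian_imagForm g)
  rw [det_imagForm, show (-1 : ℤ√(-2)).re = -1 from rfl] at h
  linarith

/-- A plane of discriminant `-2` can only just separate the base point from its image under `matA`,
and the congruences modulo `4` exclude this. -/
lemma realHeight_mul_matA_mul_pos (g : SL2) : 0 < realHeight (g * matA) * realHeight g := by
  rw [realHeight, realForm_mul, height_transform_matA (isHermitian_realForm g), realHeight, height]
  have h := realForm_discriminant g
  obtain ⟨A, u, v, C, hA, hu, hv, hC⟩ := realForm_apply_eq g
  rw [hA, hu, hv, hC] at h ⊢
  have hlower : (4 * u) ^ 2 - (2 * (1 + 4 * v) - 4 * A - 4 * C) ^ 2 ≤ 2 := by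
    nlinarith [sq_nonneg (3 * (1 + 4 * v) - (4 * A + 4 * C)), sq_nonneg (A - C), sq_nonneg (A + C)]
  have hmod : (4 * u) ^ 2 - (2 * (1 + 4 * v) - 4 * A - 4 * C) ^ 2 =
      16 * (u ^ 2 - (2 * v - A - C) ^ 2 - (2 * v - A - C)) - 4 := by ring
  have hneg : (4 * u) ^ 2 - (2 * (1 + 4 * v) - 4 * A - 4 * C) ^ 2 < 0 := by
    rw [hmod] at hlower ⊢
    omega
  linarith

lemma realForm_eq_of_realHeight_mul_nonpos {g : SL2}
    (hg : realHeight (g * matU) * realHeight g ≤ 0) : realForm g = !![0, sqrtd; -sqrtd, 0] := by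
  rw [realHeight, realForm_mul, height_transform_matU (isHermitian_realForm g), realHeight,
    height] at hg
  have h := realForm_discriminant g
  obtain ⟨A, u, v, C, hA, hu, hv, hC⟩ := realForm_apply_eq g
  rw [hA, hu, hv, hC] at h hg
  have hsum : (4 * u) ^ 2 + (4 * u - 4 * A) ^ 2 + (4 * u - 4 * C) ^ 2 ≤ 4 := by nlinarith
  obtain rfl : u = 0 := by nlinarith [sq_nonneg (4 * u - 4 * A), sq_nonneg (4 * u - 4 * C)]
  obtain rfl : A = 0 := by nlinarith [sq_nonneg (4 * C)]
  obtain rfl : C = 0 := by nlinarith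
  obtain rfl : v = 0 := by
    have hv' : v * (1 + 2 * v) = 0 := by nlinarith
    exact (mul_eq_zero.1 hv').resolve_right (by omega)
  have hH := isHermitian_realForm g
  ext i j <;> fin_cases i <;> fin_cases j <;>
    simp [← hH.apply 1 0, im_apply_self_eq_zero hH, hA, hu, hv, hC]

lemma imagForm_eq_of_imagHeight_mul_nonpos {g : SL2}
    (hg : imagHeight (g * matA) * imagHeight g ≤ 0) :
    imagForm g = !![0, 1; 1, 0] ∨ imagForm g = !![0, -1; -1, 0] := by
  rw [imagHeight, imagForm_mul, height_transform_matA (isHermitian_imagForm g), imagHeight,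
    height] at hg
  have h := imagForm_discriminant g
  obtain ⟨A, u, v, C, hA, hu, hv, hC⟩ := imagForm_apply_eq g
  rw [hA, hu, hv, hC] at h hg
  have hmod : (1 + 2 * u) ^ 2 - (2 * (2 * v) - 2 * A - 2 * C) ^ 2 =
      4 * (u ^ 2 + u - (2 * v - A - C) ^ 2) + 1 := by ring
  have hpos : 0 < (1 + 2 * u) ^ 2 - (2 * (2 * v) - 2 * A - 2 * C) ^ 2 := by
    have : 0 ≤ (1 + 2 * u) ^ 2 - (2 * (2 * v) - 2 * A - 2 * C) ^ 2 := by linarith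
    omega
  have hAC : A ^ 2 - A * C + C ^ 2 ≤ 0 := by
    nlinarith [sq_nonneg (6 * (2 * v) - 2 * (2 * A + 2 * C))]
  obtain rfl : A = 0 := by nlinarith [sq_nonneg (2 * C - A)]
  obtain rfl : C = 0 := by nlinarith
  obtain rfl : v = 0 := by nlinarith
  have hH := isHermitian_imagForm g
  have hu' : (1 + 2 * u) ^ 2 = 1 := by linarith
  refine (sq_eq_one_iff.1 hu').imp (fun hu' => ?_) fun hu' => ?_ <;>
  · ext i j <;> fin_cases i <;> fin_cases j <;>
      simp [← hH.apply 1 0, im_apply_self_eq_zero hH, hA, hu, hu', hv, hC]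

end HermitianForms

section Subgroups

lemma mem_zpowers_iff_of_mul_self_eq_neg_one {G : Type*} [Group G] [HasDistribNeg G] {x : G}
    (hx : x * x = -1) (g : G) :
    g ∈ Subgroup.zpowers x ↔ g = 1 ∨ g = -1 ∨ g = x ∨ g = -x := by
  have hneg : -1 ∈ Subgroup.zpowers x :=
    hx ▸ mul_mem (Subgroup.mem_zpowers x) (Subgroup.mem_zpowers x)
  constructor
  · rw [Subgroup.mem_zpowers_iff]
    rintro ⟨n, rfl⟩
    have hinv : x⁻¹ = -x := inv_eq_of_mul_eq_one_right (by rw [mul_neg, hx, neg_neg])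
    induction n with
    | zero => simp
    | succ n ih =>
      rw [_root_.zpow_add_one]
      rcases ih with h | h | h | h <;> simp [h, hx]
    | pred n ih =>
      rw [_root_.zpow_sub_one, hinv]
      rcases ih with h | h | h | h <;> simp [h, hx]
  · rintro (rfl | rfl | rfl | rfl)
    · exact one_mem _
    · exact hneg
    · exact Subgroup.mem_zpowers _
    · simpa only [neg_one_mul] using mul_mem hneg (Subgroup.mem_zpowers x)

lemma mem_gamma0_iff {g : SL2} : g ∈ Gamma0SqrtNegTwo ↔ Even (g 1 0).re := by
  change g 1 0 ∈ Ideal.span {(sqrtd : ℤ√(-2))} ↔ _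
  rw [Ideal.mem_span_singleton]
  constructor
  · rintro ⟨x, hx⟩
    exact ⟨-x.im, by simp [hx]; ring⟩
  · rintro ⟨n, hn⟩
    exact ⟨⟨(g 1 0).im, -n⟩, by ext <;> simp [hn]; ring⟩

lemma matW_mem_gamma0 : matW ∈ Gamma0SqrtNegTwo := mem_gamma0_iff.2 (by decide)

lemma matI_mem_gamma0 : matI ∈ Gamma0SqrtNegTwo := mem_gamma0_iff.2 (by decide)

lemma zpowers_matW_le_gamma0 : Subgroup.zpowers matW ≤ Gamma0SqrtNegTwo :=
  Subgroup.zpowers_le.2 matW_mem_gamma0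

lemma conj_mem_zpowers_matW_iff {g : SL2} :
    matS⁻¹ * g * matS ∈ Subgroup.zpowers matW ↔ g ∈ Subgroup.zpowers matI := by
  simp only [Subgroup.mem_zpowers_iff, matI_eq, conj_zpow, mul_inv_eq_iff_eq_mul, mul_assoc matS⁻¹,
    eq_inv_mul_iff_mul_eq]

/-- The matrices with entries in `ℤ`, as a subgroup of `SL₂(ℤ[√-2])`. -/
def realGroup : Subgroup SL2 where
  carrier := {g | ∀ i j, (g i j).im = 0}
  one_mem' := by decide
  mul_mem' {g h} hg hh i j := by
    rw [mul_apply_two]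
    simp [hg i 0, hg i 1, hh 0 j, hh 1 j]
  inv_mem' {g} hg := by
    rw [SpecialLinearGroup.SL2_inv_expl]
    intro i j
    fin_cases i <;> fin_cases j <;> simp [hg _ _]

lemma mem_realGroup_iff {g : SL2} : g ∈ realGroup ↔ ∀ i j, (g i j).im = 0 := Iff.rfl

lemma det_re_of_mem_realGroup {g : SL2} (hg : g ∈ realGroup) :
    (g 0 0).re * (g 1 1).re - (g 0 1).re * (g 1 0).re = 1 := by
  simpa [mem_realGroup_iff.1 hg _ _] using det_re g

lemma matR_mem_realGroup : matR ∈ realGroup := mem_realGroup_iff.2 (by decide)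

lemma matT_mem_realGroup : matT ∈ realGroup := mem_realGroup_iff.2 (by decide)

/-- The matrices which preserve, for every translate of the real plane, the side on which the base
point lies. All transforms of the base point under this group lie in one chamber of the complement
of the translates. -/
def regionGroup : Subgroup SL2 where
  carrier := {g | ∀ m, 0 < realHeight (m * g) ↔ 0 < realHeight m}
  one_mem' m := by rw [mul_one]
  mul_mem' {g h} hg hh m := by rw [← mul_assoc, hh, hg]
  inv_mem' {g} hg m := by rw [← hg, inv_mul_cancel_right]

lemma matW_mem_regionGroup : matW ∈ regionGroup := fun m => by rw [realHeight_mul_matW]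

lemma matS_mem_regionGroup : matS ∈ regionGroup := fun m => by rw [realHeight_mul_matS]

lemma matA_mem_regionGroup : matA ∈ regionGroup := fun m =>
  pos_iff_pos_of_mul_pos (realHeight_mul_matA_mul_pos m)

lemma matT_mem_regionGroup : matT ∈ regionGroup :=
  matT_eq ▸ mul_mem (inv_mem matA_mem_regionGroup) matS_mem_regionGroup

lemma matR_mem_regionGroup : matR ∈ regionGroup :=
  matR_eq ▸ mul_mem (mul_mem matS_mem_regionGroup matA_mem_regionGroup)
    (inv_mem matS_mem_regionGroup)

lemma matI_mem_regionGroup : matI ∈ regionGroup :=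
  matI_eq ▸ mul_mem (mul_mem matS_mem_regionGroup matW_mem_regionGroup)
    (inv_mem matS_mem_regionGroup)

lemma neg_one_mem_regionGroup : -1 ∈ regionGroup :=
  matA_mul_matA ▸ mul_mem matA_mem_regionGroup matA_mem_regionGroup

end Subgroups

section RealPlane

lemma conjTranspose_mul_eq_of_transform_eq {g : SL2} {X Y : Matrix (Fin 2) (Fin 2) (ℤ√(-2))}
    (h : (g.1)ᴴ * X * g.1 = Y) :
    (g.1)ᴴ * X = Y * !![g 1 1, -g 0 1; -g 1 0, g 0 0] := by
  rw [← h, Matrix.mul_assoc, ← adjugate_fin_two, mul_adjugate, g.2, one_smul, Matrix.mul_one]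

lemma mem_realGroup_of_realForm_eq {g : SL2} (hg : realForm g = !![0, sqrtd; -sqrtd, 0]) :
    g ∈ realGroup := by
  have h := fun i j => congrFun₂ (conjTranspose_mul_eq_of_transform_eq hg) i j
  simp [Fin.forall_fin_two, Zsqrtd.ext_iff, mul_apply, Fin.sum_univ_two] at h
  refine fun i j => ?_
  fin_cases i <;> fin_cases j <;> simp <;> omega

lemma realHeight_pos_of_mem_realGroup {g : SL2} (hg : g ∈ realGroup) :
    0 < realHeight g ∧ ¬ 0 < realHeight (g * matU) := by
  have hdet := det_re_of_mem_realGroup hg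
  rw [realHeight, realHeight, realForm_mul, height_transform_matU (isHermitian_realForm g), height]
  simp [realForm, mul_apply, Fin.sum_univ_two, mem_realGroup_iff.1 hg _ _]
  constructor <;> linarith

lemma realHeight_mul_matU_pos_iff {g : SL2} (hg : g ∉ realGroup) :
    0 < realHeight (g * matU) ↔ 0 < realHeight g := by
  refine pos_iff_pos_of_mul_pos (lt_of_not_ge fun h => hg ?_)
  exact mem_realGroup_of_realForm_eq (realForm_eq_of_realHeight_mul_nonpos h)

end RealPlane

section ImaginaryPlane

lemma imagHeight_neg (g : SL2) : imagHeight (-g) = imagHeight g := by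
  simp [imagHeight, imagForm]

lemma imagHeight_mul_matT (g : SL2) : imagHeight (g * matT) = imagHeight (g * matA) := by
  rw [show matT = -(matA * matS) by decide, mul_neg, imagHeight_neg, ← mul_assoc,
    imagHeight_mul_matS]

lemma imagForm_eq_or_imagForm_mul_matA_eq {g : SL2}
    (hg : imagHeight (g * matA) * imagHeight g ≤ 0) :
    imagForm g = !![0, 1; 1, 0] ∨ imagForm (g * matA) = !![0, 1; 1, 0] := by
  refine (imagForm_eq_of_imagHeight_mul_nonpos hg).imp_right fun h => ?_
  rw [imagForm_mul, h]
  decide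

lemma im_eq_zero_and_re_eq_zero_of_imagForm_eq {g : SL2} (hg : imagForm g = !![0, 1; 1, 0]) :
    (g 0 0).im = 0 ∧ (g 0 1).re = 0 ∧ (g 1 0).re = 0 ∧ (g 1 1).im = 0 := by
  have h := fun i j => congrFun₂ (conjTranspose_mul_eq_of_transform_eq hg) i j
  simp [Fin.forall_fin_two, Zsqrtd.ext_iff, mul_apply, Fin.sum_univ_two] at h
  omega

lemma entries_of_imaginary {a b c d : ℤ} (hdet : a * d + 2 * b * c = 1)
    (h1 : 1 ≤ a * d + a * c - b * d) (hU : a * d + a * c - b * d ≤ c ^ 2 + (c + d) ^ 2)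
    (hUW : a * d + a * c - b * d ≤ (a - b) ^ 2 + b ^ 2)
    (hW : 3 * (a * d + a * c - b * d) - 1 ≤ (a - b) ^ 2 + b ^ 2 + (c ^ 2 + (c + d) ^ 2)) :
    (a = 1 ∧ b = 0 ∧ c = 0 ∧ d = 1) ∨ (a = -1 ∧ b = 0 ∧ c = 0 ∧ d = -1) ∨
    (a = 1 ∧ b = 1 ∧ c = 1 ∧ d = -1) ∨ (a = -1 ∧ b = -1 ∧ c = -1 ∧ d = 1) := by
  have hmul : (c ^ 2 + (c + d) ^ 2) * ((a - b) ^ 2 + b ^ 2) =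
      2 * (a * d + a * c - b * d) ^ 2 - 2 * (a * d + a * c - b * d) + 1 := by
    linear_combination (a * d + 2 * b * c + 1 - 2 * (a * d + a * c - b * d)) * hdet
  have hone : a * d + a * c - b * d = 1 := by
    nlinarith [mul_nonneg (sub_nonneg.2 hU) (sub_nonneg.2 hUW)]
  rw [hone] at hU hUW hmul
  have hcd : c ^ 2 + (c + d) ^ 2 = 1 := by nlinarith
  have hab : (a - b) ^ 2 + b ^ 2 = 1 := by nlinarith
  have hbound : |c| ≤ 1 ∧ |c + d| ≤ 1 ∧ |b| ≤ 1 ∧ |a - b| ≤ 1 := by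
    refine ⟨?_, ?_, ?_, ?_⟩ <;> rw [← sq_le_one_iff_abs_le_one] <;>
      nlinarith [sq_nonneg c, sq_nonneg (c + d), sq_nonneg b, sq_nonneg (a - b)]
  simp only [Int.abs_le_one_iff] at hbound
  obtain ⟨rfl | rfl | rfl, hd | hd | hd, rfl | rfl | rfl, ha | ha | ha⟩ := hbound <;>
    grind

lemma mem_zpowers_matW_of_imagForm_eq {g : SL2} (hg : g ∈ regionGroup)
    (h : imagForm g = !![0, 1; 1, 0]) : g ∈ Subgroup.zpowers matW := by
  obtain ⟨ha, hb, hc, hd⟩ := im_eq_zero_and_re_eq_zero_of_imagForm_eq h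
  have hdet := det_re g
  have h1 := (hg 1).2 (by decide)
  have hU := mt (hg matU).1 (by decide)
  have hW := (hg matW).2 (by decide)
  have hUW := mt (hg (matU * matW)).1 (by decide)
  simp [realHeight, realForm, height, mul_apply, Fin.sum_univ_two, vecMul, dotProduct, ha, hb,
    hc, hd] at hdet h1 hU hW hUW
  rw [mem_zpowers_iff_of_mul_self_eq_neg_one matW_mul_matW]
  have hent := entries_of_imaginary (a := (g 0 0).re) (b := (g 0 1).im) (c := (g 1 0).im)
    (d := (g 1 1).re) (by linarith) (by linarith) (by linarith) (by linarith) (by linarith)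
  refine hent.imp ?_ (Or.imp ?_ (Or.imp ?_ ?_)) <;> rintro ⟨ha', hb', hc', hd'⟩ <;>
    apply ext_entries <;> ext <;> simp [*]

lemma imagHeight_of_mem_zpowers_matW {g : SL2} (hg : g ∈ Subgroup.zpowers matW) :
    0 < imagHeight g ∧ ¬ 0 < imagHeight (g * matA) := by
  rw [mem_zpowers_iff_of_mul_self_eq_neg_one matW_mul_matW] at hg
  rcases hg with rfl | rfl | rfl | rfl <;> decide

end ImaginaryPlane

section Sides

variable {g : SL2}

lemma matA_notMem_gamma0 : matA ∉ Gamma0SqrtNegTwo := mt mem_gamma0_iff.1 (by decide)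

lemma matS_notMem_gamma0 : matS ∉ Gamma0SqrtNegTwo := mt mem_gamma0_iff.1 (by decide)

lemma matA_mul_matS_inv_notMem_gamma0 : matA * matS⁻¹ ∉ Gamma0SqrtNegTwo :=
  mt mem_gamma0_iff.1 (by decide)

lemma mul_matA_notMem_zpowers_matW (hg : g ∈ Gamma0SqrtNegTwo) :
    g * matA ∉ Subgroup.zpowers matW := fun h =>
  matA_notMem_gamma0 ((Subgroup.mul_mem_cancel_left _ hg).1 (zpowers_matW_le_gamma0 h))

lemma matS_inv_mul_notMem_zpowers_matW (hg : g ∈ Gamma0SqrtNegTwo) :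
    matS⁻¹ * g ∉ Subgroup.zpowers matW := fun h =>
  matS_notMem_gamma0 (inv_mem_iff.1
    ((Subgroup.mul_mem_cancel_right _ hg).1 (zpowers_matW_le_gamma0 h)))

lemma matS_inv_mul_mul_matA_notMem_zpowers_matW (hg : g ∈ Gamma0SqrtNegTwo) :
    matS⁻¹ * g * matA ∉ Subgroup.zpowers matW := fun h => by
  have hconj : g * (matA * matS⁻¹) ∈ Subgroup.zpowers matI := by
    rw [← conj_mem_zpowers_matW_iff]
    simpa only [mul_assoc, inv_mul_cancel, mul_one] using h
  exact matA_mul_matS_inv_notMem_gamma0 ((Subgroup.mul_mem_cancel_left _ hg).1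
    (Subgroup.zpowers_le.2 matI_mem_gamma0 hconj))

/-- The matrices for which the image of the base point lies above the imaginary plane and in the
same chamber as the base point. -/
def SideImag (g : SL2) : Prop := g ∈ regionGroup ∧ 0 < imagHeight g

lemma sideImag_mul_matW : SideImag (g * matW) ↔ SideImag g := by
  rw [SideImag, SideImag, Subgroup.mul_mem_cancel_right _ matW_mem_regionGroup,
    imagHeight_mul_matW]

lemma sideImag_mul_matS : SideImag (g * matS) ↔ SideImag g := by
  rw [SideImag, SideImag, Subgroup.mul_mem_cancel_right _ matS_mem_regionGroup,
    imagHeight_mul_matS]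

lemma sideImag_mul_matI : SideImag (g * matI) ↔ SideImag g := by
  rw [matI_eq, ← mul_assoc, ← sideImag_mul_matS, inv_mul_cancel_right, ← mul_assoc,
    sideImag_mul_matW, sideImag_mul_matS]

lemma sideImag_mul_matT : SideImag (g * matT) ↔ SideImag (g * matA) := by
  rw [SideImag, SideImag, Subgroup.mul_mem_cancel_right _ matT_mem_regionGroup,
    Subgroup.mul_mem_cancel_right _ matA_mem_regionGroup, imagHeight_mul_matT]

lemma sideImag_neg : SideImag (-g) ↔ SideImag g := by
  have hmem := Subgroup.mul_mem_cancel_right regionGroup (y := g) neg_one_mem_regionGroup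
  rw [mul_neg_one] at hmem
  rw [SideImag, SideImag, hmem, imagHeight_neg]

lemma sideImag_mul_matA (h : g ∉ Subgroup.zpowers matW) (h' : g * matA ∉ Subgroup.zpowers matW) :
    SideImag (g * matA) ↔ SideImag g := by
  rw [SideImag, SideImag, Subgroup.mul_mem_cancel_right _ matA_mem_regionGroup]
  refine and_congr_right fun hg => pos_iff_pos_of_mul_pos (lt_of_not_ge fun hle => ?_)
  rcases imagForm_eq_or_imagForm_mul_matA_eq hle with hform | hform
  · exact h (mem_zpowers_matW_of_imagForm_eq hg hform)
  · exact h' (mem_zpowers_matW_of_imagForm_eq (mul_mem hg matA_mem_regionGroup) hform)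

lemma sideImag_of_mem_zpowers_matW (h : g ∈ Subgroup.zpowers matW) :
    SideImag g ∧ ¬ SideImag (g * matA) := by
  obtain ⟨hpos, hnot⟩ := imagHeight_of_mem_zpowers_matW h
  exact ⟨⟨Subgroup.zpowers_le.2 matW_mem_regionGroup h, hpos⟩, fun h' => hnot h'.2⟩

lemma sideImag_matS_inv_mul_matT (hg : g ∈ Gamma0SqrtNegTwo) :
    SideImag (matS⁻¹ * (g * matT)) ↔ SideImag (matS⁻¹ * g) := by
  rw [← mul_assoc, sideImag_mul_matT, sideImag_mul_matA (matS_inv_mul_notMem_zpowers_matW hg)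
    (matS_inv_mul_mul_matA_notMem_zpowers_matW hg)]

/-- The side `SideImag` of the imaginary plane with the stabilizer of its face at the base point
removed, so that `matA` preserves it. -/
def SideImagOff (g : SL2) : Prop := Xor (SideImag g) (g ∈ Subgroup.zpowers matW)

lemma sideImagOff_mul_matW : SideImagOff (g * matW) ↔ SideImagOff g := by
  rw [SideImagOff, SideImagOff, sideImag_mul_matW,
    Subgroup.mul_mem_cancel_right _ (Subgroup.mem_zpowers matW)]

lemma sideImagOff_mul_matA : SideImagOff (g * matA) ↔ SideImagOff g := by
  rw [SideImagOff, SideImagOff]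
  by_cases h : g ∈ Subgroup.zpowers matW
  · have h' := mul_matA_notMem_zpowers_matW (zpowers_matW_le_gamma0 h)
    simp [Xor, h, h', sideImag_of_mem_zpowers_matW h]
  by_cases h' : g * matA ∈ Subgroup.zpowers matW
  · obtain ⟨hside, hnot⟩ := sideImag_of_mem_zpowers_matW h'
    rw [mul_assoc, matA_mul_matA, mul_neg_one, sideImag_neg] at hnot
    simp [Xor, h, h', hside, hnot]
  · simp [h, h', sideImag_mul_matA h h']

/-- The side `SideImagOff` of the imaginary plane, transported by `matS`. -/
def SideConj (g : SL2) : Prop := SideImagOff (matS⁻¹ * g * matS)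

lemma sideConj_iff : SideConj g ↔ Xor (SideImag (matS⁻¹ * g)) (g ∈ Subgroup.zpowers matI) := by
  rw [SideConj, SideImagOff, sideImag_mul_matS, conj_mem_zpowers_matW_iff]

lemma sideConj_mul_matI : SideConj (g * matI) ↔ SideConj g := by
  rw [SideConj, mul_assoc, mul_assoc g, matI_mul_matS, ← mul_assoc g, ← mul_assoc,
    sideImagOff_mul_matW, ← mul_assoc, SideConj]

lemma sideConj_mul_matR : SideConj (g * matR) ↔ SideConj g := by
  rw [SideConj, mul_assoc, mul_assoc g, matR_mul_matS, ← mul_assoc g, ← mul_assoc,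
    sideImagOff_mul_matA, ← mul_assoc, SideConj]

end Sides

section HalfPlane

variable {g : SL2}

/-- A half-plane for the action of the matrices with entries in `ℤ` on the hyperbolic plane. -/
def RealSide (g : SL2) : Prop := g ∈ realGroup ∧
  0 < 2 * ((g 0 0).re * (g 1 1).re) - 1
    - ((g 0 0).re * (g 1 0).re + 2 * ((g 0 1).re * (g 1 1).re))

lemma realSide_mul_matR : RealSide (g * matR) ↔ RealSide g := by
  rw [RealSide, RealSide, Subgroup.mul_mem_cancel_right _ matR_mem_realGroup]
  refine and_congr_right fun h => ?_
  simp only [mul_apply_two, coe_matR, of_apply, cons_val', cons_val_zero, cons_val_fin_one,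
    cons_val_one, mul_neg, mul_one, neg_mul, mul_zero, add_zero, Zsqrtd.re_add, Zsqrtd.re_neg,
    Zsqrtd.re_mul, Zsqrtd.re_ofNat, Zsqrtd.im_ofNat, Nat.cast_ofNat]
  constructor <;> intro <;> linarith [det_re_of_mem_realGroup h]

lemma sq_lt_sq_of_det_eq_one {a b c d : ℤ} (hdet : a * d - b * c = 1) (hc : Even c)
    (hne : a * c ≠ 0 ∨ b * d ≠ 0) : (2 * (a * d) - 1) ^ 2 < (a * c + 2 * (b * d)) ^ 2 := by
  have hdiff : (2 * (a * d) - 1) ^ 2 - (a * c + 2 * (b * d)) ^ 2 =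
      1 - ((a * c) ^ 2 + 4 * (b * d) ^ 2) := by
    linear_combination 4 * a * d * hdet
  have hpos : 0 < (a * c) ^ 2 + 4 * (b * d) ^ 2 := by
    rcases hne with h | h <;> positivity
  refine lt_of_le_of_ne (by linarith) fun heq => ?_
  obtain ⟨e, rfl⟩ := hc
  have hY : a * (e + e) + 2 * (b * d) = 2 * (a * e + b * d) := by ring
  rw [hY] at heq
  rcases sq_eq_sq_iff_eq_or_eq_neg.1 heq with h | h <;> omega

lemma mul_ne_zero_of_mem_realGroup (hg : g ∈ Gamma0SqrtNegTwo) (hreal : g ∈ realGroup)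
    (h1 : g ≠ 1) (h2 : g ≠ -1) :
    (g 0 0).re * (g 1 0).re ≠ 0 ∨ (g 0 1).re * (g 1 1).re ≠ 0 := by
  have hdet := det_re_of_mem_realGroup hreal
  have hc := mem_gamma0_iff.1 hg
  by_contra! ⟨hac, hbd⟩
  have had : ¬ Even ((g 0 0).re * (g 1 1).re) := fun h => by
    have h' := h.sub (hc.mul_left (g 0 1).re)
    rw [hdet] at h'
    exact absurd h' (by decide)
  have hc0 : (g 1 0).re = 0 := (mul_eq_zero.1 hac).resolve_left fun h => had (by simp [h])
  have hb0 : (g 0 1).re = 0 := (mul_eq_zero.1 hbd).resolve_right fun h => had (by simp [h])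
  have him := mem_realGroup_iff.1 hreal
  rw [hb0, zero_mul, sub_zero] at hdet
  rcases Int.mul_eq_one_iff_eq_one_or_neg_one.1 hdet with ⟨ha, hd⟩ | ⟨ha, hd⟩
  · exact h1 (by apply ext_entries <;> ext <;> simp [him _ _, ha, hd, hb0, hc0])
  · exact h2 (by apply ext_entries <;> ext <;> simp [him _ _, ha, hd, hb0, hc0])

lemma realSide_mul_matT (hg : g ∈ Gamma0SqrtNegTwo) (h1 : g ≠ 1) (h2 : g ≠ -1) :
    RealSide (g * matT) ↔ RealSide g := by
  rw [RealSide, RealSide, Subgroup.mul_mem_cancel_right _ matT_mem_realGroup]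
  refine and_congr_right fun hreal => ?_
  have hdet := det_re_of_mem_realGroup hreal
  have hlt := sq_lt_sq_of_det_eq_one hdet (mem_gamma0_iff.1 hg)
    (mul_ne_zero_of_mem_realGroup hg hreal h1 h2)
  have hvalue : 2 * (((g * matT) 0 0).re * ((g * matT) 1 1).re) - 1 -
      (((g * matT) 0 0).re * ((g * matT) 1 0).re +
        2 * (((g * matT) 0 1).re * ((g * matT) 1 1).re)) =
      -(2 * ((g 0 0).re * (g 1 1).re) - 1) -
        ((g 0 0).re * (g 1 0).re + 2 * ((g 0 1).re * (g 1 1).re)) := by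
    simp [mul_apply_two]
    linear_combination 2 * hdet
  rw [hvalue]
  exact pos_iff_pos_of_mul_pos (by linarith)

lemma realSide_one_or_neg_one (h : g = 1 ∨ g = -1) : RealSide g ∧ ¬ RealSide (g * matT) := by
  rcases h with rfl | rfl <;>
    simp [RealSide, mem_realGroup_iff, Fin.forall_fin_two]

end HalfPlane

section Descent

lemma le_of_exists_mul_mem_lt {G : Type*} [Group G] {H K : Subgroup G} (size : G → ℕ)
    (hdescent : ∀ g ∈ K, g ∉ H → ∃ h ∈ H, g * h ∈ K ∧ size (g * h) < size g) : K ≤ H := by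
  intro g hg
  induction hn : size g using Nat.strong_induction_on generalizing g with
  | _ n ih =>
    subst hn
    by_contra hgH
    obtain ⟨h, hh, hmem, hlt⟩ := hdescent g hg hgH
    exact hgH ((Subgroup.mul_mem_cancel_right _ hh).1 (ih _ hlt hmem rfl))

end Descent

section Division

lemma exists_two_mul_abs_add_mul_le {c : ℤ} (hc : c ≠ 0) (d : ℤ) :
    ∃ n, 2 * |d + c * n| ≤ |c| := by
  refine ⟨-round (d / c : ℚ), ?_⟩
  have hc' : (c : ℚ) ≠ 0 := Int.cast_ne_zero.2 hc
  have h := mul_le_mul_of_nonneg_left (abs_sub_round (d / c : ℚ)) (abs_nonneg (c : ℚ))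
  rw [← abs_mul, mul_sub, mul_div_cancel₀ _ hc'] at h
  have h' : 2 * |(d : ℚ) + c * -(round (d / c : ℚ) : ℚ)| ≤ |(c : ℚ)| := by
    rw [mul_neg, ← sub_eq_add_neg]
    linarith
  exact_mod_cast h'

variable {c : ℤ√(-2)}

lemma norm_eq (x : ℤ√(-2)) : x.norm = x.re ^ 2 + 2 * x.im ^ 2 := by
  rw [Zsqrtd.norm]
  ring

lemma norm_nonneg (x : ℤ√(-2)) : 0 ≤ x.norm := Zsqrtd.norm_nonneg (by decide) x

lemma norm_pos {x : ℤ√(-2)} (hx : x ≠ 0) : 0 < x.norm :=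
  (norm_nonneg x).lt_of_ne' (mt (Zsqrtd.norm_eq_zero_iff (by decide) x).1 hx)

lemma norm_mul_norm_eq (x c : ℤ√(-2)) :
    x.norm * c.norm = (x * star c).re ^ 2 + 2 * (x * star c).im ^ 2 := by
  rw [← norm_eq, Zsqrtd.norm_mul, Zsqrtd.norm_conj]

lemma add_mul_mul_star (d c q : ℤ√(-2)) :
    (d + c * q) * star c = d * star c + (c.norm : ℤ√(-2)) * q := by
  rw [Zsqrtd.norm_eq_mul_conj]
  ring

lemma exists_two_mul_abs_mul_star_le (hc : c ≠ 0) (d : ℤ√(-2)) :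
    ∃ q, 2 * |((d + c * q) * star c).re| ≤ c.norm ∧ 2 * |((d + c * q) * star c).im| ≤ c.norm := by
  have hN := norm_pos hc
  obtain ⟨m, hm⟩ := exists_two_mul_abs_add_mul_le hN.ne' (d * star c).re
  obtain ⟨n, hn⟩ := exists_two_mul_abs_add_mul_le hN.ne' (d * star c).im
  rw [abs_of_pos hN] at hm hn
  exact ⟨⟨m, n⟩, by simpa [add_mul_mul_star] using hm, by simpa [add_mul_mul_star] using hn⟩

lemma exists_four_mul_norm_add_mul_le (hc : c ≠ 0) (d : ℤ√(-2)) :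
    ∃ q, 4 * (d + c * q).norm ≤ 3 * c.norm := by
  have hN := norm_pos hc
  obtain ⟨q, hre, him⟩ := exists_two_mul_abs_mul_star_le hc d
  have hre' := pow_le_pow_left₀ (by positivity) hre 2
  have him' := pow_le_pow_left₀ (by positivity) him 2
  rw [mul_pow, sq_abs] at hre' him'
  refine ⟨q, le_of_mul_le_mul_right ?_ hN⟩
  rw [mul_assoc, norm_mul_norm_eq]
  linarith

lemma exists_sq_two_mul_add_eq (e N : ℤ) :
    ∃ i : ℤ, (2 * e + (2 * i - 1) * N) ^ 2 = (2 * |e| - N) ^ 2 := by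
  rcases abs_choice e with h | h
  · exact ⟨0, by rw [h]; ring⟩
  · exact ⟨1, by rw [h]; ring⟩

/-- Either `d / c` is close to an element of `ℤ[√-2]`, or it is close to a translate of the deep
hole `(1 + √-2) / 2`, from which all elements have distance at least `√3 / 2`. -/
lemma exists_two_mul_norm_le_or_exists_norm_lt (hc : c ≠ 0) (d : ℤ√(-2)) :
    (∃ q, 2 * (d + c * q).norm ≤ c.norm) ∨
      ∃ q, (2 * (d + c * q) - (1 + sqrtd) * c).norm < c.norm := by
  have hN := norm_pos hc
  obtain ⟨q, hre, him⟩ := exists_two_mul_abs_mul_star_le hc d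
  set p := (d + c * q) * star c with hp
  by_cases hle : 2 * (p.re ^ 2 + 2 * p.im ^ 2) ≤ c.norm * c.norm
  · refine .inl ⟨q, le_of_mul_le_mul_right ?_ hN⟩
    rwa [mul_assoc, norm_mul_norm_eq]
  obtain ⟨i, hi⟩ := exists_sq_two_mul_add_eq p.re c.norm
  obtain ⟨j, hj⟩ := exists_sq_two_mul_add_eq p.im c.norm
  refine .inr ⟨q + ⟨i, j⟩, lt_of_mul_lt_mul_right ?_ hN.le⟩
  have hstar : (2 * (d + c * (q + ⟨i, j⟩)) - (1 + sqrtd) * c) * star c =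
      2 * p + (2 * ⟨i, j⟩ - (1 + sqrtd)) * (c.norm : ℤ√(-2)) := by
    rw [hp, Zsqrtd.norm_eq_mul_conj]
    ring
  have hre' : (2 * p + (2 * ⟨i, j⟩ - (1 + sqrtd)) * (c.norm : ℤ√(-2)) : ℤ√(-2)).re =
      2 * p.re + (2 * i - 1) * c.norm := by simp
  have him' : (2 * p + (2 * ⟨i, j⟩ - (1 + sqrtd)) * (c.norm : ℤ√(-2)) : ℤ√(-2)).im =
      2 * p.im + (2 * j - 1) * c.norm := by simp
  rw [norm_mul_norm_eq, hstar, hre', him', hi, hj]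
  have hre_sq : 2 * p.re ^ 2 ≤ c.norm * |p.re| := by nlinarith [abs_nonneg p.re, sq_abs p.re]
  have him_sq : 2 * p.im ^ 2 ≤ c.norm * |p.im| := by nlinarith [abs_nonneg p.im, sq_abs p.im]
  nlinarith [sq_abs p.re, sq_abs p.im]

end Division

section Generators

lemma upper_add (x y : ℤ√(-2)) : upper (x + y) = upper x * upper y := by
  apply ext_entries <;> simp [mul_apply_two, add_comm]

lemma lower_add (x y : ℤ√(-2)) : lower (x + y) = lower x * lower y := by
  apply ext_entries <;> simp [mul_apply_two]

lemma lower_two : lower 2 = matT * matR := by decide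

lemma lower_sqrtd : lower sqrtd = matW * matU⁻¹ := by decide

lemma upper_zsmul (n : ℤ) (x : ℤ√(-2)) : upper (n • x) = upper x ^ n :=
  map_zpow (MonoidHom.mk' (fun y : Multiplicative (ℤ√(-2)) => upper y.toAdd)
    fun _ _ => upper_add _ _) (.ofAdd x) n

lemma lower_zsmul (n : ℤ) (x : ℤ√(-2)) : lower (n • x) = lower x ^ n :=
  map_zpow (MonoidHom.mk' (fun y : Multiplicative (ℤ√(-2)) => lower y.toAdd)
    fun _ _ => lower_add _ _) (.ofAdd x) n

variable {H : Subgroup SL2} {g : SL2}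

lemma upper_intCast_mem (hT : matT ∈ H) (n : ℤ) : upper n ∈ H := by
  rw [← zsmul_one, upper_zsmul]
  exact zpow_mem hT n

lemma upper_mem (hT : matT ∈ H) (hU : matU ∈ H) (x : ℤ√(-2)) : upper x ∈ H := by
  have hx : x = (x.re : ℤ√(-2)) + x.im • sqrtd := by ext <;> simp
  rw [hx, upper_add, upper_zsmul]
  exact mul_mem (upper_intCast_mem hT _) (zpow_mem hU _)

lemma lower_two_mul_intCast_mem (hT : matT ∈ H) (hR : matR ∈ H) (n : ℤ) : lower (2 * n) ∈ H := by
  rw [mul_comm, ← zsmul_eq_mul, lower_zsmul, lower_two]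
  exact zpow_mem (mul_mem hT hR) n

lemma lower_sqrtd_mul_mem (hT : matT ∈ H) (hU : matU ∈ H) (hW : matW ∈ H) (hR : matR ∈ H)
    (x : ℤ√(-2)) : lower (sqrtd * x) ∈ H := by
  have hx : sqrtd * x = 2 * ((-x.im : ℤ) : ℤ√(-2)) + x.re • sqrtd := by ext <;> simp
  rw [hx, lower_add, lower_zsmul, lower_sqrtd]
  exact mul_mem (lower_two_mul_intCast_mem hT hR _) (zpow_mem (mul_mem hW (inv_mem hU)) _)

lemma eq_upper_or_eq_neg_upper (hc : g 1 0 = 0) : ∃ x, g = upper x ∨ g = -upper x := by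
  have hdet : g 0 0 * g 1 1 = 1 := by
    have h := g.det_coe
    rwa [det_fin_two, hc, mul_zero, sub_zero] at h
  have hnorm : (g 0 0).norm = 1 := Int.eq_one_of_mul_eq_one_right (norm_nonneg _)
    (by rw [← Zsqrtd.norm_mul, hdet, Zsqrtd.norm_one])
  rw [norm_eq] at hnorm
  have him : (g 0 0).im = 0 := by nlinarith [sq_nonneg (g 0 0).re]
  rw [him] at hnorm
  rcases sq_eq_one_iff.1 (by linarith : (g 0 0).re ^ 2 = 1) with hre | hre
  · have ha : g 0 0 = 1 := Zsqrtd.ext hre him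
    rw [ha, one_mul] at hdet
    exact ⟨g 0 1, .inl (by apply ext_entries <;> simp [ha, hdet, hc])⟩
  · have ha : g 0 0 = -1 := Zsqrtd.ext hre him
    have hd : g 1 1 = -1 := by
      rwa [ha, neg_one_mul, neg_eq_iff_eq_neg] at hdet
    exact ⟨-g 0 1, .inr (by apply ext_entries <;> simp [ha, hd, hc])⟩

lemma mem_of_apply_eq_zero (hneg : -1 ∈ H) (hH : ∀ x, g ∈ ({upper x, -upper x} : Set SL2) →
    upper x ∈ H) (hc : g 1 0 = 0) : g ∈ H := by
  obtain ⟨x, hx⟩ := eq_upper_or_eq_neg_upper hc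
  have hmem := hH x hx
  rcases hx with rfl | rfl
  · exact hmem
  · simpa only [neg_one_mul] using mul_mem hneg hmem

lemma ne_zero_of_mem_gamma0 (hg : g ∈ Gamma0SqrtNegTwo) : g 1 1 ≠ 0 := fun h => by
  obtain ⟨n, hn⟩ := mem_gamma0_iff.1 hg
  have hdet := det_re g
  rw [h, hn, Zsqrtd.re_zero, Zsqrtd.im_zero] at hdet
  have hpar : 2 * ((g 0 1).im * (g 1 0).im - (g 0 1).re * n) = 1 := by linarith
  omega

lemma exists_mul_mem_natAbs_re_lt (hT : matT ∈ H) (hR : matR ∈ H)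
    (hg : g ∈ Gamma0SqrtNegTwo ⊓ realGroup) (hc : g 1 0 ≠ 0) :
    ∃ h ∈ H, g * h ∈ Gamma0SqrtNegTwo ⊓ realGroup ∧
      ((g * h) 1 0).re.natAbs < (g 1 0).re.natAbs := by
  have him := mem_realGroup_iff.1 hg.2
  have hc' : (g 1 0).re ≠ 0 := fun h => hc (Zsqrtd.ext h (him 1 0))
  obtain ⟨p, hp⟩ := exists_two_mul_abs_add_mul_le hc' (g 1 1).re
  have hup : upper p ∈ Gamma0SqrtNegTwo ⊓ realGroup :=
    ⟨mem_gamma0_iff.2 (by simp), mem_realGroup_iff.2 (by simp [Fin.forall_fin_two])⟩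
  obtain ⟨d, hd⟩ : ∃ d, d = (g 1 1).re + (g 1 0).re * p := ⟨_, rfl⟩
  have hd0 : d ≠ 0 := fun h => ne_zero_of_mem_gamma0 (mul_mem hg hup).1
    (Zsqrtd.ext (by simp [mul_apply_two]; linarith) (by simp [mul_apply_two, him _ _]))
  obtain ⟨q, hq⟩ := exists_two_mul_abs_add_mul_le (mul_ne_zero two_ne_zero hd0) (g 1 0).re
  have hlow : lower (2 * q) ∈ Gamma0SqrtNegTwo ⊓ realGroup :=
    ⟨mem_gamma0_iff.2 (by simp), mem_realGroup_iff.2 (by simp [Fin.forall_fin_two])⟩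
  refine ⟨upper p * lower (2 * q), mul_mem (upper_intCast_mem hT p)
    (lower_two_mul_intCast_mem hT hR q), mul_mem hg (mul_mem hup hlow), ?_⟩
  have hentry : ((g * (upper p * lower (2 * q))) 1 0).re = (g 1 0).re + 2 * d * q := by
    simp [mul_apply_two, hd]
    ring
  rw [hentry]
  rw [← hd] at hp
  rw [abs_mul, abs_two] at hq
  zify
  linarith [abs_pos.2 hc']

lemma gamma0_inf_realGroup_le (hT : matT ∈ H) (hR : matR ∈ H) :
    Gamma0SqrtNegTwo ⊓ realGroup ≤ H := by
  refine le_of_exists_mul_mem_lt (fun g => (g 1 0).re.natAbs) fun g hg hgH =>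
    exists_mul_mem_natAbs_re_lt hT hR hg fun hc => hgH ?_
  refine mem_of_apply_eq_zero (matR_mul_matR ▸ mul_mem hR hR) (fun x hx => ?_) hc
  have hx' : x = (x.re : ℤ√(-2)) := by
    have him := mem_realGroup_iff.1 hg.2 0 1
    refine Zsqrtd.ext rfl ?_
    rcases hx with rfl | rfl <;> simpa using him
  rw [hx']
  exact upper_intCast_mem hT _

lemma exists_mul_mem_norm_lt (hT : matT ∈ H) (hU : matU ∈ H) (hW : matW ∈ H) (hI : matI ∈ H)
    (hR : matR ∈ H) (hg : g ∈ Gamma0SqrtNegTwo) (hc : g 1 0 ≠ 0) :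
    ∃ h ∈ H, g * h ∈ Gamma0SqrtNegTwo ∧ ((g * h) 1 0).norm.natAbs < (g 1 0).norm.natAbs := by
  have hup (x) : upper x ∈ Gamma0SqrtNegTwo := mem_gamma0_iff.2 (by simp)
  have hlow (x) : lower (sqrtd * x) ∈ Gamma0SqrtNegTwo := mem_gamma0_iff.2 (by simp)
  have hpos := norm_pos hc
  rcases exists_two_mul_norm_le_or_exists_norm_lt hc (g 1 1) with ⟨q, hq⟩ | ⟨q, hq⟩
  · obtain ⟨d, hd⟩ : ∃ d, d = g 1 1 + g 1 0 * q := ⟨_, rfl⟩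
    have hd0 : d ≠ 0 := fun h => ne_zero_of_mem_gamma0 (mul_mem hg (hup q))
      (by simpa [mul_apply_two, add_comm, hd] using h)
    have hnorm : (d * sqrtd).norm = 2 * d.norm := by
      rw [Zsqrtd.norm_mul, mul_comm]
      rfl
    have hd0' : d * sqrtd ≠ 0 := fun h => (norm_pos hd0).ne' (by simpa [h] using hnorm)
    obtain ⟨y, hy⟩ := exists_four_mul_norm_add_mul_le hd0' (g 1 0)
    refine ⟨upper q * lower (sqrtd * y), mul_mem (upper_mem hT hU q)
      (lower_sqrtd_mul_mem hT hU hW hR y), mul_mem hg (mul_mem (hup q) (hlow y)), ?_⟩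
    have hentry : (g * (upper q * lower (sqrtd * y))) 1 0 = g 1 0 + d * sqrtd * y := by
      simp [mul_apply_two, hd]
      ring
    rw [hentry]
    rw [← hd] at hq
    have hnonneg := norm_nonneg (g 1 0 + d * sqrtd * y)
    omega
  · refine ⟨upper q * matI, mul_mem (upper_mem hT hU q) hI,
      mul_mem hg (mul_mem (hup q) matI_mem_gamma0), ?_⟩
    have hentry : (g * (upper q * matI)) 1 0 = 2 * (g 1 1 + g 1 0 * q) - (1 + sqrtd) * g 1 0 := by
      simp [mul_apply_two]
      ring
    rw [hentry]
    have hnonneg := norm_nonneg (2 * (g 1 1 + g 1 0 * q) - (1 + sqrtd) * g 1 0)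
    omega

lemma gamma0_le (hT : matT ∈ H) (hU : matU ∈ H) (hW : matW ∈ H) (hI : matI ∈ H)
    (hR : matR ∈ H) : Gamma0SqrtNegTwo ≤ H :=
  le_of_exists_mul_mem_lt (fun g => (g 1 0).norm.natAbs) fun _ hg hgH =>
    exists_mul_mem_norm_lt hT hU hW hI hR hg fun hc => hgH
      (mem_of_apply_eq_zero (matR_mul_matR ▸ mul_mem hR hR) (fun x _ => upper_mem hT hU x) hc)

end Generators

end BianchiTwo

namespace QuaternionPair

open Matrix MatrixResolution

section Twist

variable {R : Type*} [Ring R] {p q t : R}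

lemma dCyclic_mul_of_mul_eq (h : p * t = t * q) : ∀ n, dCyclic p n * t = t * dCyclic q n
  | 0 => by simp only [dCyclic, add_mul, mul_add, one_mul, mul_one, h]
  | 1 => by
    have h_sq : p * p * t = t * (q * q) := by rw [mul_assoc, h, ← mul_assoc, h, mul_assoc]
    have h_cube : p * (p * p) * t = t * (q * (q * q)) := by
      rw [mul_assoc, h_sq, ← mul_assoc, h, mul_assoc]
    simp only [dCyclic, add_mul, mul_add, one_mul, mul_one, h, h_sq, h_cube]
  | n + 2 => dCyclic_mul_of_mul_eq h n

lemma mu_mul_of_mul_eq (h : p * t = t * q) : ∀ n, mu p n * t = t * mu q n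
  | 0 => by simp only [mu, one_mul, mul_one]
  | 1 => by simp only [mu, add_mul, mul_add, one_mul, mul_one, h]
  | n + 2 => mu_mul_of_mul_eq h n

end Twist

section Square

lemma module_add_self (R : Type*) {M : Type*} [Ring R] [CharP R 2] [AddCommGroup M] [Module R M]
    (x : M) : x + x = 0 := by
  rw [← two_smul R x, CharTwo.two_eq_zero, zero_smul]

variable {R M : Type*} [Ring R] [CharP R 2] [AddCommGroup M] [Module R M]

lemma square_relation_P {t u : R} (j : R) (h : t * u = u * t) (a b c : M) :
    (1 + u) • (a + b + t • (a + c)) + (u * (1 + t)) • (1 + j) • a +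
      (((1 + t) * (1 + u * j)) • a + (1 + u) • (b + t • c)) = 0 := by
  have cancel_left (x y : M) : x + (x + y) = y := by
    rw [← add_assoc, module_add_self R, zero_add]
  simp only [module_add_self R, cancel_left, smul_smul, smul_add, add_smul,
    mul_add, add_mul, add_assoc, add_comm, add_left_comm, one_smul, mul_one, one_mul, ← mul_assoc,
    h]

lemma square_relation_Q (t w j : R) (a b c : M) :
    (1 + t) • (a + b + w • ((1 + j) • a + j • (a + c))) +
      (((1 + t) * (1 + w)) • a + (1 + t) • (b + (w * j) • c)) = 0 := by
  have cancel_left (x y : M) : x + (x + y) = y := by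
    rw [← add_assoc, module_add_self R, zero_add]
  simp only [module_add_self R, cancel_left, smul_smul, smul_add, add_smul,
    mul_add, add_mul, add_assoc, add_comm, add_left_comm, one_smul, mul_one, one_mul, ← mul_assoc]

end Square

/-- Two quaternion pairs with the same element `i`, and two further elements `t` and `u`. With
`v = u P.j Q.j`, the relations express that `t` and `v` conjugate `P.k` to `P.j` and `Q.k` to
`Q.j`, so that they identify the subgroups attached to the two ends of an edge, and that `t` and
`u` commute, which is the relation given by the face. -/
structure Gluing (R : Type*) [Ring R] where
  P : QuaternionPair R
  Q : QuaternionPair R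
  t : R
  u : R
  i_eq : Q.i = P.i
  j_mul_t : P.j * t = t * P.k
  j_mul_v : Q.j * (u * P.j * Q.j) = u * P.j * Q.j * Q.k
  t_mul_u : t * u = u * t
  z_mul : ∀ x, P.z * x = x * P.z

namespace Gluing

variable {R : Type*} [Ring R] (D : Gluing R)

/-- The element which closes up the edge with stabilizer `⟨Q.j⟩`. -/
def v : R := D.u * D.P.j * D.Q.j

/-- The differential of the resolutions of the vertex stabilizers. -/
def dVertex (n : ℕ) :
    Matrix (Fin (rk (n + 1)) ⊕ Fin (rk (n + 1))) (Fin (rk n) ⊕ Fin (rk n)) R :=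
  fromBlocks (D.P.dQuat n) 0 0 (D.Q.dQuat n)

/-- The diagonal of the differential of the resolutions of the edge stabilizers. -/
def edgeDiff (n : ℕ) : Fin 3 → R :=
  ![dCyclic D.P.i n, dCyclic D.P.j n, dCyclic D.Q.j n]

/-- The boundary from the edges to the vertices. -/
def edgeVertex (n : ℕ) : Matrix (Fin 3) (Fin (rk n) ⊕ Fin (rk n)) R :=
  .of ![Sum.elim (D.P.phiI n) (D.Q.phiI n),
    Sum.elim (D.P.phiJ n + D.t • D.P.phiK n) 0,
    Sum.elim 0 (D.Q.phiJ n + D.v • D.Q.phiK n)]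

/-- The boundary from the face to the edges. -/
def faceEdge (n : ℕ) : Fin 3 → R :=
  ![(1 + D.t) * (1 + D.u * D.P.j) * mu D.P.i n, (1 + D.u) * mu D.P.j n, (1 + D.t) * mu D.Q.j n]

/-- The component at the first vertex of the homotopy from the face to the vertices. -/
def faceVertexP (n : ℕ) : Fin (rk (n + 1)) → R :=
  (1 + D.u) • (D.P.homIJ n + D.t • D.P.homIK n) + (D.u * (1 + D.t)) • D.P.homJ n

/-- The component at the second vertex of the homotopy from the face to the vertices. -/
def faceVertexQ (n : ℕ) : Fin (rk (n + 1)) → R :=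
  (1 + D.t) • (D.Q.homIJ n + (D.u * D.P.j) • (D.Q.homJ n + D.Q.j • D.Q.homIK n))

/-- The homotopy from the face to the vertices. -/
def faceVertex (n : ℕ) : Fin (rk (n + 1)) ⊕ Fin (rk (n + 1)) → R :=
  Sum.elim (D.faceVertexP n) (D.faceVertexQ n)

lemma z_eq : D.Q.z = D.P.z := by rw [z, z, D.i_eq]

lemma one_add_z_smul_smul {n : ℕ} (x : R) (w : Fin n → R) :
    (1 + D.P.z) • x • w = x • (1 + D.P.z) • w := by
  rw [smul_smul, smul_smul, add_mul, mul_add, D.z_mul, one_mul, mul_one]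

lemma sumElim_vecMul_dVertex (n : ℕ) (a b : Fin (rk (n + 1)) → R) :
    Sum.elim a b ᵥ* D.dVertex n = Sum.elim (a ᵥ* D.P.dQuat n) (b ᵥ* D.Q.dQuat n) := by
  simp [dVertex, vecMul_fromBlocks]

lemma smul_sumElim {m n : Type*} (x : R) (a : m → R) (b : n → R) :
    x • Sum.elim a b = Sum.elim (x • a) (x • b) := by
  ext (i | i) <;> rfl

lemma faceEdge_vecMul_edgeVertex (n : ℕ) : D.faceEdge n ᵥ* D.edgeVertex n = Sum.elim
    (((1 + D.t) * (1 + D.u * D.P.j)) • mu D.P.i n • D.P.phiI n +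
      (1 + D.u) • (mu D.P.j n • D.P.phiJ n + D.t • mu D.P.k n • D.P.phiK n))
    (((1 + D.t) * (1 + D.u * D.P.j)) • mu D.Q.i n • D.Q.phiI n +
      (1 + D.t) • (mu D.Q.j n • D.Q.phiJ n + (D.u * D.P.j * D.Q.j) • mu D.Q.k n • D.Q.phiK n)) := by
  rw [smul_smul (D.u * _ * _), smul_smul D.t, ← mu_mul_of_mul_eq D.j_mul_t,
    ← mu_mul_of_mul_eq D.j_mul_v, D.i_eq]
  ext (i | i)
  · simp [vecMul, dotProduct, Fin.sum_univ_three, faceEdge, edgeVertex, mul_add, mul_assoc]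
  · simp [vecMul, dotProduct, Fin.sum_univ_three, faceEdge, edgeVertex, mul_add, mul_assoc, v]

lemma j_pow_four (S : QuaternionPair R) : S.j * (S.j * (S.j * S.j)) = 1 := by
  simp

variable [CharP R 2]

lemma dVertex_mul (n : ℕ) : D.dVertex (n + 1) * D.dVertex n = 0 := by
  simp [dVertex, fromBlocks_multiply, dQuat_mul_dQuat]

lemma diagonal_edgeDiff_mul (n : ℕ) :
    diagonal (D.edgeDiff (n + 1)) * diagonal (D.edgeDiff n) = 0 := by
  rw [diagonal_mul_diagonal, diagonal_eq_zero]
  ext i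
  fin_cases i
  · exact dCyclic_mul_dCyclic D.P.i_pow_four n
  · exact dCyclic_mul_dCyclic (j_pow_four D.P) n
  · exact dCyclic_mul_dCyclic (j_pow_four D.Q) n

lemma phiJ_add_smul_phiK_succ_vecMul (S : QuaternionPair R) {t : R} (h : S.j * t = t * S.k)
    (n : ℕ) : (S.phiJ (n + 1) + t • S.phiK (n + 1)) ᵥ* S.dQuat n =
      dCyclic S.j n • (S.phiJ n + t • S.phiK n) := by
  rw [add_vecMul, smul_vecMul, phiJ_succ_vecMul, phiK_succ_vecMul, smul_add, smul_smul, smul_smul,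
    dCyclic_mul_of_mul_eq h]

lemma edgeVertex_vecMul (n : ℕ) (i : Fin 3) :
    D.edgeVertex (n + 1) i ᵥ* D.dVertex n = D.edgeDiff n i • D.edgeVertex n i := by
  fin_cases i
  · change Sum.elim _ _ ᵥ* _ = dCyclic D.P.i n • Sum.elim _ _
    rw [sumElim_vecMul_dVertex, smul_sumElim, phiI_succ_vecMul, phiI_succ_vecMul, D.i_eq]
  · change Sum.elim _ _ ᵥ* _ = dCyclic D.P.j n • Sum.elim _ _
    rw [sumElim_vecMul_dVertex, smul_sumElim, phiJ_add_smul_phiK_succ_vecMul _ D.j_mul_t,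
      zero_vecMul, smul_zero]
  · change Sum.elim _ _ ᵥ* _ = dCyclic D.Q.j n • Sum.elim _ _
    rw [sumElim_vecMul_dVertex, smul_sumElim, v, phiJ_add_smul_phiK_succ_vecMul _ D.j_mul_v,
      zero_vecMul, smul_zero]

lemma edgeVertex_mul (n : ℕ) :
    D.edgeVertex (n + 1) * D.dVertex n + diagonal (D.edgeDiff n) * D.edgeVertex n = 0 := by
  ext i c
  rw [Matrix.add_apply, diagonal_mul, mul_apply_eq_vecMul, edgeVertex_vecMul]
  exact CharTwo.add_self_eq_zero _

lemma faceEdge_vecMul (n : ℕ) :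
    D.faceEdge (n + 1) ᵥ* diagonal (D.edgeDiff n) + (1 + D.P.z) • D.faceEdge n = 0 := by
  have key : ∀ x g : R, g * g = D.P.z →
      x * mu g (n + 1) * dCyclic g n + (1 + D.P.z) * (x * mu g n) = 0 := fun x g hg => by
    have hz : (1 + D.P.z) * x = x * (1 + D.P.z) := by
      rw [mul_add, add_mul, D.z_mul, one_mul, mul_one]
    rw [mul_assoc, mu_mul_dCyclic _ n, hg, ← mul_assoc, ← mul_assoc, hz, CharTwo.add_self_eq_zero]
    rw [← mul_assoc, hg, z, mul_assoc, D.P.i_pow_four]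
  ext i
  rw [Pi.add_apply, vecMul_diagonal]
  fin_cases i
  · exact key _ _ rfl
  · exact key _ _ D.P.j_mul_j
  · exact key _ _ (D.Q.j_mul_j.trans D.z_eq)

lemma faceVertex_zero_vecMul :
    D.faceVertex 0 ᵥ* D.dVertex 0 + D.faceEdge 0 ᵥ* D.edgeVertex 0 = 0 := by
  rw [faceVertex, sumElim_vecMul_dVertex, faceEdge_vecMul_edgeVertex, ← Sum.elim_add_add,
    ← Sum.elim_zero_zero]
  congr 1
  · rw [faceVertexP, add_vecMul, smul_vecMul, add_vecMul, smul_vecMul, smul_vecMul]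
    rw [homIJ_zero_vecMul, homIK_zero_vecMul, homJ_zero_vecMul]
    exact square_relation_P _ D.t_mul_u _ _ _
  · rw [faceVertexQ, smul_vecMul, add_vecMul, smul_vecMul, add_vecMul, smul_vecMul]
    rw [homIJ_zero_vecMul, homIK_zero_vecMul, homJ_zero_vecMul]
    exact square_relation_Q _ _ _ _ _ _

lemma faceVertexP_succ_vecMul (n : ℕ) :
    D.faceVertexP (n + 1) ᵥ* D.P.dQuat (n + 1) + (1 + D.P.z) • D.faceVertexP n =
      (1 + D.u) • (mu D.P.i (n + 1) • D.P.phiI (n + 1) + mu D.P.j (n + 1) • D.P.phiJ (n + 1) +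
        D.t • (mu D.P.i (n + 1) • D.P.phiI (n + 1) + mu D.P.k (n + 1) • D.P.phiK (n + 1))) +
      (D.u * (1 + D.t)) • (1 + D.P.j) • mu D.P.i (n + 1) • D.P.phiI (n + 1) := by
  rw [← homIJ_succ_vecMul, ← homIK_succ_vecMul, ← homJ_succ_vecMul]
  simp only [faceVertexP, add_vecMul, smul_vecMul, one_add_z_smul_smul, smul_add]
  abel

lemma faceVertexQ_succ_vecMul (n : ℕ) :
    D.faceVertexQ (n + 1) ᵥ* D.Q.dQuat (n + 1) + (1 + D.P.z) • D.faceVertexQ n =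
      (1 + D.t) • (mu D.Q.i (n + 1) • D.Q.phiI (n + 1) + mu D.Q.j (n + 1) • D.Q.phiJ (n + 1) +
        (D.u * D.P.j) • ((1 + D.Q.j) • mu D.Q.i (n + 1) • D.Q.phiI (n + 1) +
          D.Q.j • (mu D.Q.i (n + 1) • D.Q.phiI (n + 1) +
            mu D.Q.k (n + 1) • D.Q.phiK (n + 1)))) := by
  rw [← homIJ_succ_vecMul, ← homIK_succ_vecMul, ← homJ_succ_vecMul]
  simp only [faceVertexQ, add_vecMul, smul_vecMul, one_add_z_smul_smul, smul_add, D.z_eq]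
  abel

lemma faceVertex_succ_vecMul (n : ℕ) :
    D.faceVertex (n + 1) ᵥ* D.dVertex (n + 1) + D.faceEdge (n + 1) ᵥ* D.edgeVertex (n + 1) +
      (1 + D.P.z) • D.faceVertex n = 0 := by
  rw [add_right_comm, faceVertex, faceVertex, sumElim_vecMul_dVertex, faceEdge_vecMul_edgeVertex,
    smul_sumElim, ← Sum.elim_add_add, ← Sum.elim_add_add, ← Sum.elim_zero_zero]
  congr 1
  · rw [faceVertexP_succ_vecMul, square_relation_P _ D.t_mul_u]
  · rw [faceVertexQ_succ_vecMul, square_relation_Q]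

/-- The three columns of the resolution: vertices, edges and faces. -/
def columns : ThreeColumns R (fun n => Fin (rk n) ⊕ Fin (rk n)) (fun _ => Fin 3)
    (fun _ => Fin 1) where
  dA := D.dVertex
  dB n := diagonal (D.edgeDiff n)
  dC _ := of fun _ _ => 1 + D.P.z
  f := D.edgeVertex
  g n := of fun _ => D.faceEdge n
  h n := of fun _ => D.faceVertex n
  dA_mul := D.dVertex_mul
  dB_mul := D.diagonal_edgeDiff_mul
  dC_mul _ := by
    ext
    simp [Matrix.mul_apply, z, mul_add, add_mul, mul_assoc, add_assoc, CharTwo.add_self_eq_zero,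
      CharTwo.add_cancel_left]
  f_mul := D.edgeVertex_mul
  g_mul n := by
    ext _ c
    simpa [Matrix.mul_apply, vecMul, dotProduct] using congrFun (D.faceEdge_vecMul n) c
  h_zero_mul := by
    ext _ c
    exact congrFun D.faceVertex_zero_vecMul c
  h_succ_mul n := by
    ext _ c
    simpa [Matrix.mul_apply, vecMul, dotProduct] using congrFun (D.faceVertex_succ_vecMul n) c

end Gluing

variable {R : Type*} [Ring R]

/-- The left ideal generated by `1 + q` for `q` in the quaternion group. -/
def augIdeal (S : QuaternionPair R) : Ideal R := Ideal.span {1 + S.i, 1 + S.j}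

section AugIdeal

variable (S : QuaternionPair R)

lemma one_add_i_mem_augIdeal : 1 + S.i ∈ S.augIdeal := Ideal.subset_span (by simp)

lemma one_add_j_mem_augIdeal : 1 + S.j ∈ S.augIdeal := Ideal.subset_span (by simp)

variable [CharP R 2]

lemma one_add_k_mem_augIdeal : 1 + S.k ∈ S.augIdeal := by
  have h : 1 + S.k = (1 + S.i) + S.i * (1 + S.j) := by
    rw [k, mul_add, mul_one, add_assoc, CharTwo.add_cancel_left]
  rw [h]
  exact add_mem S.one_add_i_mem_augIdeal (S.augIdeal.mul_mem_left _ S.one_add_j_mem_augIdeal)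

end AugIdeal

namespace Gluing

variable (D : Gluing R)

/-- The part of the exactness of the columns and of their homology in degree zero which depends on
the ring. The last four conditions are the exactness at the edges and at the face of the complex
of the homology groups in degree zero. -/
structure IsAcyclic : Prop where
  isFree_P : D.P.IsFree
  isFree_Q : D.Q.IsFree
  of_mul_one_add_z : ∀ x, x * (1 + D.P.z) = 0 → ∃ y, y * (1 + D.P.z) = x
  of_mem_augIdeal : ∀ a b c, a + b * (1 + D.t) ∈ D.P.augIdeal →
    a + c * (1 + D.v) ∈ D.Q.augIdeal → c ∈ Ideal.span {1 + D.Q.j, 1 + D.t}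
  of_mem_augIdeal_Q : ∀ a b, a + b * (1 + D.t) ∈ D.P.augIdeal → a ∈ D.Q.augIdeal →
    a ∈ Ideal.span {1 + D.P.i}
  of_mem_augIdeal_P : ∀ b, b * (1 + D.t) ∈ D.P.augIdeal → b ∈ Ideal.span {1 + D.P.j}
  of_face : ∀ a c, a * (1 + D.Q.j) + c * (1 + D.t) = 0 → c ∈ Ideal.span {1 + D.P.z}

lemma sumElim_vecMul_dVertex_zero_add (a a' : Fin (rk 1) → R) (b : Fin 3 → R) :
    Sum.elim a a' ᵥ* D.dVertex 0 + b ᵥ* D.edgeVertex 0 = Sum.elim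
      (fun _ => a 0 * (1 + D.P.i) + a 1 * (1 + D.P.j) + (b 0 + b 1 * (1 + D.t)))
      (fun _ => a' 0 * (1 + D.Q.i) + a' 1 * (1 + D.Q.j) + (b 0 + b 2 * (1 + D.v))) := by
  rw [sumElim_vecMul_dVertex]
  ext (i | i) <;> fin_cases i <;> simp [edgeVertex, dQuat, phiI, phiJ, phiK] <;> rfl

lemma vecMul_diagonal_edgeDiff_zero_add (b : Fin 3 → R) (c : Fin 1 → R) :
    b ᵥ* diagonal (D.edgeDiff 0) + c ᵥ* of (fun _ => D.faceEdge 0) =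
      ![b 0 * (1 + D.P.i) + c 0 * ((1 + D.t) * (1 + D.u * D.P.j)),
        b 1 * (1 + D.P.j) + c 0 * (1 + D.u), b 2 * (1 + D.Q.j) + c 0 * (1 + D.t)] := by
  ext i
  rw [Pi.add_apply, vecMul_diagonal]
  fin_cases i <;> simp [vecMul, dotProduct, edgeDiff, faceEdge, dCyclic, mu]

variable {D} [CharP R 2]

lemma one_add_j_mul_one_add_v_mem : (1 + D.Q.j) * (1 + D.v) ∈ D.Q.augIdeal := by
  have h : (1 + D.Q.j) * (1 + D.v) = (1 + D.Q.j) + D.v * (1 + D.Q.k) := by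
    rw [mul_add, mul_one, add_mul, mul_add, mul_one, one_mul, v, D.j_mul_v]
  rw [h]
  exact add_mem D.Q.one_add_j_mem_augIdeal
    (D.Q.augIdeal.mul_mem_left _ D.Q.one_add_k_mem_augIdeal)

lemma one_add_v_add_mem : (1 + D.v) + (1 + D.u * D.P.j) ∈ D.Q.augIdeal := by
  have h : (1 + D.v) + (1 + D.u * D.P.j) = D.u * D.P.j * (1 + D.Q.j) := by
    rw [v, mul_add, mul_one, add_add_add_comm, CharTwo.add_self_eq_zero, zero_add, add_comm]
  rw [h]
  exact D.Q.augIdeal.mul_mem_left _ D.Q.one_add_j_mem_augIdeal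

lemma face_boundary_add_mem :
    (1 + D.t) * (1 + D.u * D.P.j) + (1 + D.u) * (1 + D.t) ∈ D.P.augIdeal := by
  have comm : (1 + D.u) * (1 + D.t) = (1 + D.t) * (1 + D.u) :=
    (Commute.one_left _).add_left ((Commute.one_right _).add_right D.t_mul_u.symm)
  have h : (1 + D.t) * (1 + D.u * D.P.j) + (1 + D.u) * (1 + D.t) =
      (1 + D.t) * D.u * (1 + D.P.j) := by
    rw [comm, ← mul_add, add_add_add_comm, CharTwo.add_self_eq_zero, zero_add,
      mul_assoc (1 + D.t), mul_one_add D.u, add_comm (D.u * D.P.j)]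
  rw [h]
  exact D.P.augIdeal.mul_mem_left _ D.P.one_add_j_mem_augIdeal

/-- Subtracting from the edge chain a multiple of the boundary of the face removes its third
component, and then `of_mem_augIdeal_Q` and `of_mem_augIdeal_P` apply. -/
lemma IsAcyclic.exists_edge_chain (hD : D.IsAcyclic) {a b c : R}
    (hP : a + b * (1 + D.t) ∈ D.P.augIdeal) (hQ : a + c * (1 + D.v) ∈ D.Q.augIdeal) :
    ∃ x y z w, x * (1 + D.P.i) + w * ((1 + D.t) * (1 + D.u * D.P.j)) = a ∧
      y * (1 + D.P.j) + w * (1 + D.u) = b ∧ z * (1 + D.Q.j) + w * (1 + D.t) = c := by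
  obtain ⟨z, w, rfl⟩ := Ideal.mem_span_pair.1 (hD.of_mem_augIdeal a b c hP hQ)
  set s := (1 + D.t) * (1 + D.u * D.P.j) with hs
  have hQ' : a + w * s ∈ D.Q.augIdeal := by
    have h : a + w * s = a + (z * (1 + D.Q.j) + w * (1 + D.t)) * (1 + D.v) +
        (z * ((1 + D.Q.j) * (1 + D.v)) + w * (1 + D.t) * ((1 + D.v) + (1 + D.u * D.P.j))) := by
      rw [mul_add (w * _), add_mul _ _ (1 + D.v), mul_assoc z, mul_assoc w _ (1 + D.u * D.P.j),
        ← hs, add_assoc a, ← add_assoc _ (w * (1 + D.t) * _), CharTwo.add_cancel_left]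
    rw [h]
    exact add_mem hQ (add_mem (D.Q.augIdeal.mul_mem_left _ one_add_j_mul_one_add_v_mem)
      (D.Q.augIdeal.mul_mem_left _ one_add_v_add_mem))
  have hP' : a + w * s + (b + w * (1 + D.u)) * (1 + D.t) ∈ D.P.augIdeal := by
    have h : a + w * s + (b + w * (1 + D.u)) * (1 + D.t) =
        a + b * (1 + D.t) + w * (s + (1 + D.u) * (1 + D.t)) := by
      rw [add_mul b, mul_add w s, mul_assoc w, add_add_add_comm]
    rw [h]
    exact add_mem hP (D.P.augIdeal.mul_mem_left _ face_boundary_add_mem)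
  obtain ⟨x, hx⟩ := Ideal.mem_span_singleton'.1 (hD.of_mem_augIdeal_Q _ _ hP' hQ')
  have hx_mem : a + w * s ∈ D.P.augIdeal :=
    hx ▸ D.P.augIdeal.mul_mem_left _ D.P.one_add_i_mem_augIdeal
  obtain ⟨y, hy⟩ := Ideal.mem_span_singleton'.1
    (hD.of_mem_augIdeal_P _ ((D.P.augIdeal.add_mem_iff_right hx_mem).1 hP'))
  exact ⟨x, y, z, w, by rw [hx, CharTwo.add_cancel_right], by rw [hy, CharTwo.add_cancel_right],
    rfl⟩

lemma IsAcyclic.isExact_columns (hD : D.IsAcyclic) : D.columns.IsExact where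
  dA n a ha := by
    obtain ⟨p, q, rfl⟩ : ∃ p q, a = Sum.elim p q := ⟨_, _, (Sum.elim_comp_inl_inr a).symm⟩
    rw [columns, sumElim_vecMul_dVertex] at ha
    obtain ⟨p', hp⟩ := hD.isFree_P.exists_vecMul_dQuat n p (congrArg (· ∘ Sum.inl) ha)
    obtain ⟨q', hq⟩ := hD.isFree_Q.exists_vecMul_dQuat n q (congrArg (· ∘ Sum.inr) ha)
    exact ⟨Sum.elim p' q', by rw [columns, sumElim_vecMul_dVertex, hp, hq]⟩
  dB n b hb := by
    have h i : b i * D.edgeDiff n i = 0 := (vecMul_diagonal b _ i).symm.trans (congrFun hb i)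
    obtain ⟨x, hx⟩ := hD.isFree_P.i n _ (h 0)
    obtain ⟨y, hy⟩ := hD.isFree_P.j n _ (h 1)
    obtain ⟨z, hz⟩ := hD.isFree_Q.j n _ (h 2)
    refine ⟨![x, y, z], funext fun i => (vecMul_diagonal _ _ i).trans ?_⟩
    fin_cases i
    exacts [hx, hy, hz]
  dC n c hc := by
    obtain ⟨y, hy⟩ := hD.of_mul_one_add_z (c 0)
      ((Fin.sum_univ_one fun l => c l * (1 + D.P.z)).symm.trans (congrFun hc 0))
    refine ⟨![y], funext fun i => ?_⟩
    fin_cases i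
    simpa [columns, vecMul, dotProduct] using hy
  f a b h := by
    obtain ⟨p, q, rfl⟩ : ∃ p q, a = Sum.elim p q := ⟨_, _, (Sum.elim_comp_inl_inr a).symm⟩
    replace h := (D.sumElim_vecMul_dVertex_zero_add p q b).symm.trans h
    have hP := CharTwo.add_eq_zero.1 (congrFun h (Sum.inl 0))
    have hQ := CharTwo.add_eq_zero.1 (congrFun h (Sum.inr 0))
    obtain ⟨x, y, z, w, h0, h1, h2⟩ := hD.exists_edge_chain
      (Ideal.mem_span_pair.2 ⟨_, _, hP⟩) (Ideal.mem_span_pair.2 ⟨_, _, hQ⟩)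
    refine ⟨![x, y, z], ![w], (D.vecMul_diagonal_edgeDiff_zero_add _ _).trans ?_⟩
    ext i
    fin_cases i
    exacts [h0, h1, h2]
  g b c h := by
    replace h := (D.vecMul_diagonal_edgeDiff_zero_add b c).symm.trans h
    obtain ⟨y, hy⟩ := Ideal.mem_span_singleton'.1 (hD.of_face (b 2) (c 0) (congrFun h 2))
    refine ⟨![y], funext fun i => ?_⟩
    fin_cases i
    simpa [columns, vecMul, dotProduct] using hy

lemma exists_vecMul_add_vecMul_eq {a : Fin (rk 0) ⊕ Fin (rk 0) → R}
    (ha : a (Sum.inl 0) + a (Sum.inr 0) ∈ Ideal.span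
      {1 + D.t, 1 + D.v, 1 + D.P.i, 1 + D.P.j, 1 + D.Q.j}) :
    ∃ a' b, a' ᵥ* D.dVertex 0 + b ᵥ* D.edgeVertex 0 = a := by
  simp only [Ideal.mem_span_insert, Ideal.mem_span_singleton'] at ha
  obtain ⟨c₁, _, ⟨c₂, _, ⟨c₃, _, ⟨c₄, _, ⟨c₅, rfl⟩, rfl⟩, rfl⟩, rfl⟩, h⟩ := ha
  refine ⟨Sum.elim ![c₃, c₄] ![0, c₅],
    ![a (Sum.inr 0) + (c₅ * (1 + D.Q.j) + c₂ * (1 + D.v)), c₁, c₂],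
    (D.sumElim_vecMul_dVertex_zero_add _ _ _).trans ?_⟩
  ext (i | i) <;> rw [Fin.fin_one_eq_zero i]
  · have h' : a (Sum.inl 0) = c₁ * (1 + D.t) + (c₂ * (1 + D.v) + (c₃ * (1 + D.P.i) +
        (c₄ * (1 + D.P.j) + c₅ * (1 + D.Q.j)))) + a (Sum.inr 0) := by
      rw [← h, CharTwo.add_cancel_right]
    rw [h']
    simp only [Sum.elim_inl, cons_val_zero, cons_val_one]
    abel
  · have h' : c₅ * (1 + D.Q.j) + (a (Sum.inr 0) + (c₅ * (1 + D.Q.j) + c₂ * (1 + D.v)) +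
        c₂ * (1 + D.v)) = a (Sum.inr 0) := by
      rw [← add_assoc (a _), CharTwo.add_cancel_right, add_left_comm, CharTwo.add_self_eq_zero,
        add_zero]
    simpa using h'

end Gluing

end QuaternionPair

namespace BianchiTwo

open Matrix MonoidAlgebra GroupRing QuaternionGroup QuaternionPair MatrixResolution

section QuaternionSubgroups

/-- The map from the quaternion group for which `x` and `y` are the images of `i` and `j`. -/
def quatFun (x y : SL2) : QuaternionGroup 2 → SL2
  | .a n => x ^ n.val
  | .xa n => y * x ^ n.val

/-- The quaternion subgroup generated by `matI` and `matW`, the stabilizer of the first vertex. -/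
def quatW : QuaternionGroup 2 →* Gamma0SqrtNegTwo :=
  MonoidHom.codRestrict
    { toFun := quatFun matI matW
      map_one' := by decide +kernel
      map_mul' := by decide +kernel } _ fun q => mem_gamma0_iff.2 (by
        revert q
        decide +kernel)

/-- The quaternion subgroup generated by `matI` and `matR`, the stabilizer of the second vertex. -/
def quatR : QuaternionGroup 2 →* Gamma0SqrtNegTwo :=
  MonoidHom.codRestrict
    { toFun := quatFun matI matR
      map_one' := by decide +kernel
      map_mul' := by decide +kernel } _ fun q => mem_gamma0_iff.2 (by
        revert q
        decide +kernel)

lemma quatW_injective : Function.Injective quatW := by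
  have : ∀ p q, quatFun matI matW p = quatFun matI matW q → p = q := by decide +kernel
  exact fun p q h => this p q (congrArg Subtype.val h)

lemma quatR_injective : Function.Injective quatR := by
  have : ∀ p q, quatFun matI matR p = quatFun matI matR q → p = q := by decide +kernel
  exact fun p q h => this p q (congrArg Subtype.val h)

@[simp] lemma coe_quatW_a_one : (quatW (a 1) : SL2) = matI := pow_one matI

@[simp] lemma coe_quatW_xa_zero : (quatW (xa 0) : SL2) = matW := mul_one matW

@[simp] lemma coe_quatR_a_one : (quatR (a 1) : SL2) = matI := pow_one matI

@[simp] lemma coe_quatR_xa_zero : (quatR (xa 0) : SL2) = matR := mul_one matR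

/-- `matT` as an element of the congruence subgroup. -/
def gammaT : Gamma0SqrtNegTwo := ⟨matT, mem_gamma0_iff.2 (by decide)⟩

/-- `matU` as an element of the congruence subgroup. -/
def gammaU : Gamma0SqrtNegTwo := ⟨matU, mem_gamma0_iff.2 (by decide)⟩

@[simp] lemma coe_gammaT : (gammaT : SL2) = matT := rfl

@[simp] lemma coe_gammaU : (gammaU : SL2) = matU := rfl

/-- The group elements attached to the vertices, edges and the face of a fundamental domain. -/
def gluing : Gluing (ZMod 2)[Gamma0SqrtNegTwo] where
  P := ofHom quatW
  Q := ofHom quatR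
  t := el gammaT
  u := el gammaU
  i_eq := congrArg el (Subtype.ext (by simp))
  j_mul_t := by
    simp only [k, ofHom, ← el_mul]
    exact congrArg el (Subtype.ext (by simp [matW_mul_matT]))
  j_mul_v := by
    simp only [k, ofHom, ← el_mul]
    exact congrArg el (Subtype.ext (by simp [matR_mul_matU_mul_matW_mul_matR]))
  t_mul_u := by
    simp only [← el_mul]
    exact congrArg el (Subtype.ext (by simp [matT_mul_matU]))
  z_mul x := by
    simp only [z, ofHom, ← el_mul]
    induction x using induction_el with
    | zero => rw [mul_zero, zero_mul]
    | add x y hx hy => rw [mul_add, add_mul, hx, hy]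
    | el g =>
      rw [← el_mul, ← el_mul]
      exact congrArg el (Subtype.ext (by simp [matI_mul_matI]))

lemma coe_quatW_a_one_sq : (quatW (a 1 * a 1) : SL2) = -1 := by
  rw [map_mul, Subgroup.coe_mul, coe_quatW_a_one, matI_mul_matI]

lemma gluing_z : gluing.P.z = el (quatW (a 1 * a 1)) := by rw [map_mul, el_mul]; rfl

/-- The group element giving `gluing.v`. -/
def gammaV : Gamma0SqrtNegTwo := gammaU * quatW (xa 0) * quatR (xa 0)

lemma coe_gammaV : (gammaV : SL2) = matU * matW * matR := by simp [gammaV]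

lemma gluing_v : gluing.v = el gammaV := by simp only [gammaV, el_mul]; rfl

end QuaternionSubgroups

section Counting

/-- The number modulo two of the group elements `g` in the support of an element of the group
ring for which `γ⁻¹ g` satisfies `p`. -/
def countMod (p : SL2 → Prop) (γ : Gamma0SqrtNegTwo) : (ZMod 2)[Gamma0SqrtNegTwo] →+ ZMod 2 :=
  pairing fun g => ind (p (γ⁻¹ * g : Gamma0SqrtNegTwo))

variable {p q r : SL2 → Prop} {g h γ : Gamma0SqrtNegTwo} {x : (ZMod 2)[Gamma0SqrtNegTwo]}

lemma countMod_mul_one_add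
    (hp : ∀ g ∈ Gamma0SqrtNegTwo, ind (p g) + ind (p (g * h)) = ind (q g)) :
    countMod p γ (x * (1 + el h)) = countMod q γ x := by
  refine pairing_mul_one_add (fun g => ?_) x
  rw [← hp _ (γ⁻¹ * g).2, ← mul_assoc]
  rfl

lemma countMod_mul_one_add_eq_zero (hp : ∀ g ∈ Gamma0SqrtNegTwo, p (g * h) ↔ p g) :
    countMod p γ (x * (1 + el h)) = 0 := by
  rw [countMod_mul_one_add (q := fun _ => False) fun g hg => by
    rw [ind_add_self (hp g hg).symm, ind_false not_false]]
  simp [countMod, ind_false]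

lemma countMod_eq_zero_of_mem_span_pair (hg : ∀ m, p (m * g) ↔ p m) (hh : ∀ m, p (m * h) ↔ p m)
    (hx : x ∈ Ideal.span {1 + el g, 1 + el h}) : countMod p γ x = 0 := by
  obtain ⟨y, z, rfl⟩ := Ideal.mem_span_pair.1 hx
  rw [map_add, countMod_mul_one_add_eq_zero fun m _ => hg m,
    countMod_mul_one_add_eq_zero fun m _ => hh m, add_zero]

lemma countMod_add (h : ∀ g, ind (p g) + ind (q g) = ind (r g)) :
    countMod p γ x + countMod q γ x = countMod r γ x := by
  rw [countMod, countMod, countMod, ← pairing_add_left]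
  simp only [h]

lemma mem_of_countMod_eq_zero {L : Subgroup SL2} {J : Ideal (ZMod 2)[Gamma0SqrtNegTwo]}
    (hL : Gamma0SqrtNegTwo ⊓ L ≤ (congrOne J).map Gamma0SqrtNegTwo.subtype)
    (hx : ∀ γ, countMod (· ∈ L) γ x = 0) : x ∈ J := by
  refine mem_of_pairing_coset (L := L.subgroupOf Gamma0SqrtNegTwo) (fun g hg => ?_) hx
  exact (Subgroup.mem_map_iff_mem Subtype.val_injective).1 (hL ⟨g.2, hg⟩)

lemma coe_mem_map_congrOne {J : Ideal (ZMod 2)[Gamma0SqrtNegTwo]} (hg : 1 + el g ∈ J) :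
    (g : SL2) ∈ (congrOne J).map Gamma0SqrtNegTwo.subtype :=
  Subgroup.mem_map_of_mem _ (mem_congrOne.2 hg)

end Counting

section Acyclic

variable {x y w : (ZMod 2)[Gamma0SqrtNegTwo]} {γ : Gamma0SqrtNegTwo} {p : SL2 → Prop}
  {J : Ideal (ZMod 2)[Gamma0SqrtNegTwo]}

lemma matT_mem_map_congrOne (h : 1 + gluing.t ∈ J) :
    matT ∈ (congrOne J).map Gamma0SqrtNegTwo.subtype :=
  coe_mem_map_congrOne (g := gammaT) h

lemma matI_mem_map_congrOne (h : 1 + gluing.P.i ∈ J) :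
    matI ∈ (congrOne J).map Gamma0SqrtNegTwo.subtype :=
  coe_quatW_a_one ▸ coe_mem_map_congrOne (g := quatW (a 1)) h

lemma matW_mem_map_congrOne (h : 1 + gluing.P.j ∈ J) :
    matW ∈ (congrOne J).map Gamma0SqrtNegTwo.subtype :=
  coe_quatW_xa_zero ▸ coe_mem_map_congrOne (g := quatW (xa 0)) h

lemma matR_mem_map_congrOne (h : 1 + gluing.Q.j ∈ J) :
    matR ∈ (congrOne J).map Gamma0SqrtNegTwo.subtype :=
  coe_quatR_xa_zero ▸ coe_mem_map_congrOne (g := quatR (xa 0)) h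

lemma neg_one_mem_map_congrOne (h : 1 + gluing.P.z ∈ J) :
    -1 ∈ (congrOne J).map Gamma0SqrtNegTwo.subtype := by
  rw [gluing_z] at h
  exact coe_quatW_a_one_sq ▸ coe_mem_map_congrOne h

lemma countMod_eq_zero_of_mem_augIdeal_P (hI : ∀ m, p (m * matI) ↔ p m)
    (hW : ∀ m, p (m * matW) ↔ p m) (hx : x ∈ gluing.P.augIdeal) : countMod p γ x = 0 :=
  countMod_eq_zero_of_mem_span_pair (by simpa using hI) (by simpa using hW) hx

lemma countMod_eq_zero_of_mem_augIdeal_Q (hI : ∀ m, p (m * matI) ↔ p m)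
    (hR : ∀ m, p (m * matR) ↔ p m) (hx : x ∈ gluing.Q.augIdeal) : countMod p γ x = 0 :=
  countMod_eq_zero_of_mem_span_pair (by simpa using hI) (by simpa using hR) hx

lemma ind_realHeight_add (g : SL2) : ind (0 < realHeight g) + ind (0 < realHeight (g * gammaV)) =
    ind (g ∈ realGroup) := by
  have h : 0 < realHeight (g * gammaV) ↔ 0 < realHeight (g * matU) := by
    rw [coe_gammaV, ← mul_assoc, ← mul_assoc]
    exact (matR_mem_regionGroup _).trans (matW_mem_regionGroup _)
  rw [ind_congr h]
  by_cases hg : g ∈ realGroup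
  · have := realHeight_pos_of_mem_realGroup hg
    rw [ind_true this.1, ind_false this.2, ind_true hg, add_zero]
  · rw [ind_add_self (realHeight_mul_matU_pos_iff hg).symm, ind_false hg]

lemma mem_span_one_add_j_one_add_t (hP : x + y * (1 + gluing.t) ∈ gluing.P.augIdeal)
    (hQ : x + w * (1 + gluing.v) ∈ gluing.Q.augIdeal) :
    w ∈ Ideal.span {1 + gluing.Q.j, 1 + gluing.t} := by
  refine mem_of_countMod_eq_zero (gamma0_inf_realGroup_le
    (matT_mem_map_congrOne (Ideal.subset_span (by simp)))
    (matR_mem_map_congrOne (Ideal.subset_span (by simp)))) fun γ => ?_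
  replace hP := countMod_eq_zero_of_mem_augIdeal_P (γ := γ) (p := (0 < realHeight ·))
    matI_mem_regionGroup matW_mem_regionGroup hP
  replace hQ := countMod_eq_zero_of_mem_augIdeal_Q (γ := γ) (p := (0 < realHeight ·))
    matI_mem_regionGroup matR_mem_regionGroup hQ
  rw [gluing_v] at hQ
  rw [map_add, gluing, countMod_mul_one_add_eq_zero fun g _ => matT_mem_regionGroup g,
    add_zero] at hP
  rwa [map_add, hP, zero_add, countMod_mul_one_add fun g _ => ind_realHeight_add g] at hQ

lemma ind_sideImag_add_ind_sideConj (g : SL2) :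
    ind (SideImag (matS⁻¹ * g)) + ind (SideConj g) = ind (g ∈ Subgroup.zpowers matI) := by
  rw [ind_congr sideConj_iff]
  by_cases h : SideImag (matS⁻¹ * g) <;> by_cases h' : g ∈ Subgroup.zpowers matI <;>
    simp [ind, Xor, h, h', CharTwo.add_self_eq_zero]

lemma mem_span_one_add_i (hP : x + y * (1 + gluing.t) ∈ gluing.P.augIdeal)
    (hQ : x ∈ gluing.Q.augIdeal) : x ∈ Ideal.span {1 + gluing.P.i} := by
  refine mem_of_countMod_eq_zero (L := Subgroup.zpowers matI) (inf_le_right.trans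
    (Subgroup.zpowers_le.2 (matI_mem_map_congrOne (Ideal.mem_span_singleton_self _)))) fun γ => ?_
  rw [← countMod_add ind_sideImag_add_ind_sideConj,
    countMod_eq_zero_of_mem_augIdeal_Q (fun _ => sideConj_mul_matI) (fun _ => sideConj_mul_matR) hQ,
    add_zero]
  replace hP := countMod_eq_zero_of_mem_augIdeal_P (γ := γ) (p := fun g => SideImag (matS⁻¹ * g))
    (fun m => by rw [← mul_assoc, sideImag_mul_matI])
    (fun m => by rw [← mul_assoc, sideImag_mul_matW]) hP
  rwa [map_add, gluing, countMod_mul_one_add_eq_zero fun g => sideImag_matS_inv_mul_matT,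
    add_zero] at hP

lemma ind_sideImag_add {g : SL2} (hg : g ∈ Gamma0SqrtNegTwo) :
    ind (SideImag g) + ind (SideImag (g * gammaT)) = ind (g ∈ Subgroup.zpowers matW) := by
  rw [coe_gammaT, ind_congr sideImag_mul_matT]
  by_cases h : g ∈ Subgroup.zpowers matW
  · have := sideImag_of_mem_zpowers_matW h
    rw [ind_true this.1, ind_false this.2, ind_true h, add_zero]
  · rw [ind_add_self (sideImag_mul_matA h (mul_matA_notMem_zpowers_matW hg)).symm, ind_false h]

lemma mem_span_one_add_j (hy : y * (1 + gluing.t) ∈ gluing.P.augIdeal) :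
    y ∈ Ideal.span {1 + gluing.P.j} := by
  refine mem_of_countMod_eq_zero (L := Subgroup.zpowers matW) (inf_le_right.trans
    (Subgroup.zpowers_le.2 (matW_mem_map_congrOne (Ideal.mem_span_singleton_self _)))) fun γ => ?_
  replace hy := countMod_eq_zero_of_mem_augIdeal_P (γ := γ) (fun _ => sideImag_mul_matI)
    (fun _ => sideImag_mul_matW) hy
  rwa [gluing, countMod_mul_one_add (p := SideImag) fun g hg => ind_sideImag_add hg] at hy

lemma mem_zpowers_neg_one_iff {G : Type*} [Group G] [HasDistribNeg G] {g : G} :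
    g ∈ Subgroup.zpowers (-1 : G) ↔ g = 1 ∨ g = -1 := by
  constructor
  · rintro ⟨n, rfl⟩
    obtain h | h := n.even_or_odd
    · exact .inl (by simp [h.neg_zpow])
    · exact .inr (by simp [h.neg_zpow])
  · rintro (rfl | rfl)
    exacts [one_mem _, Subgroup.mem_zpowers _]

lemma ind_realSide_add {g : SL2} (hg : g ∈ Gamma0SqrtNegTwo) :
    ind (RealSide g) + ind (RealSide (g * gammaT)) = ind (g ∈ Subgroup.zpowers (-1)) := by
  rw [coe_gammaT]
  by_cases h : g = 1 ∨ g = -1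
  · have := realSide_one_or_neg_one h
    rw [ind_true this.1, ind_false this.2, ind_true (mem_zpowers_neg_one_iff.2 h), add_zero]
  · obtain ⟨h1, h2⟩ := not_or.1 h
    rw [ind_add_self (realSide_mul_matT hg h1 h2).symm, ind_false (mt mem_zpowers_neg_one_iff.1 h)]

lemma mem_span_one_add_z (h : x * (1 + gluing.Q.j) + y * (1 + gluing.t) = 0) :
    y ∈ Ideal.span {1 + gluing.P.z} := by
  refine mem_of_countMod_eq_zero (L := Subgroup.zpowers (-1)) (inf_le_right.trans
    (Subgroup.zpowers_le.2 (neg_one_mem_map_congrOne (Ideal.mem_span_singleton_self _))))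
    fun γ => ?_
  have hx : countMod RealSide γ (x * (1 + gluing.Q.j)) = 0 :=
    countMod_mul_one_add_eq_zero fun g _ => by rw [coe_quatR_xa_zero, realSide_mul_matR]
  replace h := congrArg (countMod RealSide γ) h
  rwa [map_add, hx, zero_add, map_zero, gluing,
    countMod_mul_one_add fun g hg => ind_realSide_add hg] at h

lemma isAcyclic_gluing : gluing.IsAcyclic where
  isFree_P := isFree_ofHom quatW_injective
  isFree_Q := isFree_ofHom quatR_injective
  of_mul_one_add_z x hx := by
    rw [gluing_z] at hx ⊢
    refine exists_mul_one_add_el ?_ hx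
    rw [orderOf_injective quatW quatW_injective]
    exact orderOf_eq_prime (by decide) (by decide)
  of_mem_augIdeal _ _ _ := mem_span_one_add_j_one_add_t
  of_mem_augIdeal_Q _ _ := mem_span_one_add_i
  of_mem_augIdeal_P _ := mem_span_one_add_j
  of_face _ _ := mem_span_one_add_z

lemma countMod_mem_top : countMod (· ∈ (⊤ : Subgroup SL2)) γ x =
    aug (ZMod 2) Gamma0SqrtNegTwo x := by
  induction x using induction_el with
  | zero => rw [map_zero, map_zero]
  | add x y hx hy => rw [map_add, map_add, hx, hy]
  | el g => rw [countMod, pairing_el, ind_true (Subgroup.mem_top _), el, aug_single]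

lemma mem_span_of_aug_eq_zero (hx : aug (ZMod 2) Gamma0SqrtNegTwo x = 0) :
    x ∈ Ideal.span {1 + gluing.t, 1 + gluing.v, 1 + gluing.P.i, 1 + gluing.P.j,
      1 + gluing.Q.j} := by
  set J := Ideal.span {1 + gluing.t, 1 + gluing.v, 1 + gluing.P.i, 1 + gluing.P.j, 1 + gluing.Q.j}
  set H := (congrOne J).map Gamma0SqrtNegTwo.subtype
  have hW : matW ∈ H := matW_mem_map_congrOne (Ideal.subset_span (by simp))
  have hR : matR ∈ H := matR_mem_map_congrOne (Ideal.subset_span (by simp))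
  have hV : (gammaV : SL2) ∈ H :=
    coe_mem_map_congrOne (gluing_v ▸ Ideal.subset_span (by simp))
  have hU : matU ∈ H := by
    have : matU = gammaV * matR⁻¹ * matW⁻¹ := by rw [coe_gammaV]; group
    exact this ▸ H.mul_mem (H.mul_mem hV (H.inv_mem hR)) (H.inv_mem hW)
  have hT : matT ∈ H := matT_mem_map_congrOne (Ideal.subset_span (by simp))
  have hI : matI ∈ H := matI_mem_map_congrOne (Ideal.subset_span (by simp))
  refine mem_of_countMod_eq_zero (L := ⊤)
    (inf_le_left.trans (gamma0_le hT hU hW hI hR)) fun γ => ?_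
  rw [countMod_mem_top, hx]

end Acyclic

end BianchiTwo

namespace QuaternionPair

open Matrix

section Rank

lemma rank_eq_card_of_mul_eq {m n r K : Type*} [Fintype m] [Fintype n] [Fintype r] [DecidableEq r]
    [Field K] {M : Matrix m n K} (A : Matrix m r K) (B : Matrix r n K) (L : Matrix r m K)
    (N : Matrix n r K) (hM : M = A * B) (hone : L * M * N = 1) : M.rank = Fintype.card r := by
  apply le_antisymm
  · rw [hM]
    exact (rank_mul_le_left A B).trans (rank_le_card_width A)
  · rw [← rank_one (R := K) (n := r), ← hone]
    exact (rank_mul_le_left _ _).trans (rank_mul_le_right _ _)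

lemma rk_eq : ∀ n, rk n = if n % 4 = 0 ∨ n % 4 = 3 then 1 else 2
  | 0 => rfl
  | 1 => rfl
  | 2 => rfl
  | 3 => rfl
  | n + 4 => by
    rw [Nat.add_mod_right]
    exact rk_eq n

end Rank

section Augmentation

variable {R : Type*} [Ring R] {φ : R →+* ZMod 2}

lemma map_dCyclic {g : R} (hg : φ g = 1) : ∀ n, φ (dCyclic g n) = 0
  | 0 => by
    rw [dCyclic, map_add, map_one, hg]
    rfl
  | 1 => by
    simp only [dCyclic, map_add, map_mul, map_one, hg]
    rfl
  | n + 2 => map_dCyclic hg n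

lemma map_dQuat {Q : QuaternionPair R} (hi : φ Q.i = 1) (hj : φ Q.j = 1) :
    ∀ n, (Q.dQuat n).map φ = 0
  | 0 => by
    ext a b
    fin_cases a <;> fin_cases b <;> simp [dQuat, hi, hj, CharTwo.add_self_eq_zero]
  | 1 => by
    ext a b
    fin_cases a <;> fin_cases b <;> simp [dQuat, k, hi, hj, CharTwo.add_self_eq_zero]
  | 2 => by
    ext a b
    fin_cases a
    fin_cases b <;> simp [dQuat, k, hi, hj, CharTwo.add_self_eq_zero]
  | 3 => by
    ext a b
    fin_cases a
    fin_cases b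
    simp [dQuat, norm, map_dCyclic hi]
  | n + 4 => map_dQuat hi hj n

namespace Gluing

/-- The gluing in the field with two elements in which all elements are `1`. -/
def trivial : Gluing (ZMod 2) where
  P := ⟨1, 1, rfl, rfl, rfl⟩
  Q := ⟨1, 1, rfl, rfl, rfl⟩
  t := 1
  u := 1
  i_eq := rfl
  j_mul_t := rfl
  j_mul_v := rfl
  t_mul_u := rfl
  z_mul _ := mul_comm _ _

lemma rank_edgeVertex_trivial : ∀ n, (trivial.edgeVertex n).rank =
    if n % 4 = 0 then 1 else if n % 4 = 1 then 2 else 0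
  | 0 => rank_eq_card_of_mul_eq (r := Fin 1) !![1; 0; 0] (.of ![Sum.elim ![1] ![1]]) !![1, 0, 0]
      (.of (Sum.elim ![![1]] ![![0]])) (by decide) (by decide)
  | 1 => rank_eq_card_of_mul_eq (r := Fin 2) !![1, 1; 1, 0; 0, 1]
      (.of ![Sum.elim ![1, 0] ![0, 0], Sum.elim ![0, 0] ![1, 0]]) !![0, 1, 0; 0, 0, 1]
      (.of (Sum.elim ![![1, 0], ![0, 0]] ![![0, 1], ![0, 0]])) (by decide) (by decide)
  | 2 => by
    have hzero : trivial.edgeVertex 2 = 0 := by decide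
    rw [hzero, rank_zero]
    rfl
  | 3 => by
    have hzero : trivial.edgeVertex 3 = 0 := by decide
    rw [hzero, rank_zero]
    rfl
  | n + 4 => by
    rw [Nat.add_mod_right]
    exact rank_edgeVertex_trivial n

/-- The ring homomorphism `φ` sends the elements of the gluing to `1`, as does the augmentation
of a group ring when these elements come from the group. -/
structure IsAugmentation (D : Gluing R) (φ : R →+* ZMod 2) : Prop where
  map_i : φ D.P.i = 1
  map_P_j : φ D.P.j = 1
  map_Q_j : φ D.Q.j = 1
  map_t : φ D.t = 1
  map_u : φ D.u = 1

namespace IsAugmentation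

variable {D : Gluing R} (hφ : D.IsAugmentation φ)
include hφ

lemma map_Q_i : φ D.Q.i = 1 := by rw [D.i_eq, hφ.map_i]

lemma map_one_add_t : φ (1 + D.t) = 0 := by
  rw [map_add, map_one, hφ.map_t]
  rfl

lemma map_one_add_u : φ (1 + D.u) = 0 := by
  rw [map_add, map_one, hφ.map_u]
  rfl

lemma map_dVertex (n : ℕ) : (D.dVertex n).map φ = 0 := by
  rw [dVertex, fromBlocks_map, map_dQuat hφ.map_i hφ.map_P_j, map_dQuat hφ.map_Q_i hφ.map_Q_j,
    Matrix.map_zero _ (map_zero _), fromBlocks_zero]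

lemma map_edgeDiff (n : ℕ) (i : Fin 3) : φ (D.edgeDiff n i) = 0 := by
  fin_cases i
  exacts [map_dCyclic hφ.map_i n, map_dCyclic hφ.map_P_j n, map_dCyclic hφ.map_Q_j n]

lemma map_one_add_z : φ (1 + D.P.z) = 0 := by
  rw [map_add, map_one, z, map_mul, hφ.map_i]
  rfl

lemma map_faceEdge (n : ℕ) (i : Fin 3) : φ (D.faceEdge n i) = 0 := by
  fin_cases i <;> simp [faceEdge, -map_add, hφ.map_one_add_t, hφ.map_one_add_u]

lemma map_faceVertex (n : ℕ) (i : Fin (rk (n + 1)) ⊕ Fin (rk (n + 1))) :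
    φ (D.faceVertex n i) = 0 := by
  rcases i with i | i
  · change φ ((1 + D.u) * _ + D.u * (1 + D.t) * _) = 0
    rw [map_add, map_mul, map_mul, map_mul, hφ.map_one_add_t, hφ.map_one_add_u, mul_zero, zero_mul,
      zero_mul, add_zero]
  · change φ ((1 + D.t) * _) = 0
    rw [map_mul, hφ.map_one_add_t, zero_mul]

lemma map_edgeVertex (n : ℕ) : (D.edgeVertex n).map φ = trivial.edgeVertex n := by
  induction n using rk.induct with
  | case5 _ ih => exact ih
  | _ =>
    ext i (j | j) <;> fin_cases i <;> fin_cases j <;>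
      simp [edgeVertex, trivial, phiI, phiJ, phiK, v, k, z, hφ.map_i, hφ.map_Q_i, hφ.map_P_j,
        hφ.map_Q_j, hφ.map_t, hφ.map_u]

lemma rank_map_total [CharP R 2] (n : ℕ) : ((D.columns.total n).map φ).rank =
    if n % 4 = 0 then 1 else if n % 4 = 1 then 2 else 0 := by
  rw [← rank_edgeVertex_trivial, ← hφ.map_edgeVertex]
  exact D.columns.rank_map_total φ hφ.map_dVertex
    (fun n => by
      change (diagonal _).map φ = 0
      rw [diagonal_map (map_zero φ), diagonal_eq_zero]
      exact funext (hφ.map_edgeDiff n))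
    (fun _ => funext₂ fun _ _ => hφ.map_one_add_z)
    (fun n => funext₂ fun _ => hφ.map_faceEdge n)
    (fun n => funext₂ fun _ => hφ.map_faceVertex n) n

end IsAugmentation

end Gluing

end Augmentation

end QuaternionPair

namespace QuaternionPair.Gluing

open Matrix MatrixResolution MonoidAlgebra

section Cohomology

variable {G : Type} [Group G] {D : Gluing (ZMod 2)[G]}

lemma isResolution_columns (hD : D.IsAcyclic)
    (hφ : D.IsAugmentation (aug (ZMod 2) G : (ZMod 2)[G] →+* ZMod 2))
    (hgen : ∀ x, aug (ZMod 2) G x = 0 →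
      x ∈ Ideal.span {1 + D.t, 1 + D.v, 1 + D.P.i, 1 + D.P.j, 1 + D.Q.j}) :
    IsResolution (ZMod 2) G
      (fun n => (Fin (rk n) ⊕ Fin (rk n)) ⊕ Shift (fun _ => Fin 3) n ⊕
        Shift (Shift fun _ => Fin 1) n) D.columns.total :=
  haveI : Nonempty (Fin (rk 0) ⊕ Fin (rk 0)) := ⟨Sum.inl (0 : Fin 1)⟩
  isResolution_total hD.isExact_columns
    (fun i => Finset.sum_eq_zero fun j _ => congrFun₂ (hφ.map_dVertex 0) i j)
    (fun i => by
      have hsum : ∀ i, ∑ j, trivial.edgeVertex 0 i j = 0 := by decide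
      rw [← hsum i, ← hφ.map_edgeVertex]
      rfl)
    (fun a ha => exists_vecMul_add_vecMul_eq (hgen _ (by
      rw [Fintype.sum_sum_type, Fin.sum_univ_one, Fin.sum_univ_one] at ha
      rwa [map_add])))

variable (h : IsResolution (ZMod 2) G (fun n => (Fin (rk n) ⊕ Fin (rk n)) ⊕
    Shift (fun _ => Fin 3) n ⊕ Shift (Shift fun _ => Fin 1) n) D.columns.total)
  (hφ : D.IsAugmentation (aug (ZMod 2) G : (ZMod 2)[G] →+* ZMod 2))
include h hφ

lemma finrank_groupCohomology_zero :
    Module.finrank (ZMod 2) (groupCohomology (Rep.trivial (ZMod 2) G (ZMod 2)) 0) = 1 := by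
  have hrank : ((D.columns.total 0).map (aug (ZMod 2) G)).rank = 1 := hφ.rank_map_total 0
  have hfinrank := finrank_groupCohomology_zero_add_rank h
  rw [hrank] at hfinrank
  exact Nat.succ.inj hfinrank

lemma finrank_groupCohomology_one :
    Module.finrank (ZMod 2) (groupCohomology (Rep.trivial (ZMod 2) G (ZMod 2)) 1) = 4 := by
  have hrank_zero : ((D.columns.total 0).map (aug (ZMod 2) G)).rank = 1 := hφ.rank_map_total 0
  have hrank_one : ((D.columns.total 1).map (aug (ZMod 2) G)).rank = 2 := hφ.rank_map_total 1
  have hfinrank := finrank_groupCohomology_succ_add_rank_add_rank h 0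
  rw [hrank_zero, hrank_one] at hfinrank
  exact Nat.add_right_cancel (m := 3) hfinrank

lemma finrank_groupCohomology_add_two (n : ℕ) :
    Module.finrank (ZMod 2) (groupCohomology (Rep.trivial (ZMod 2) G (ZMod 2)) (n + 2)) =
      if n % 4 = 0 ∨ n % 4 = 1 then 6 else 5 := by
  have hrank : ∀ m, ((D.columns.total m).map (aug (ZMod 2) G)).rank =
    if m % 4 = 0 then 1 else if m % 4 = 1 then 2 else 0 := hφ.rank_map_total
  have hcard : Fintype.card ((Fin (rk (n + 2)) ⊕ Fin (rk (n + 2))) ⊕ Fin 3 ⊕ Fin 1) =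
      2 * rk (n + 2) + 4 := by
    simp only [Fintype.card_sum, Fintype.card_fin]
    ring
  have hfinrank := (finrank_groupCohomology_succ_add_rank_add_rank h (n + 1)).trans hcard
  rw [hrank, hrank, rk_eq] at hfinrank
  change Module.finrank (ZMod 2) (groupCohomology _ (n + 2)) + _ + _ = _ at hfinrank
  split_ifs at hfinrank ⊢ <;> omega

end Cohomology

end QuaternionPair.Gluing

namespace BianchiTwo

open MatrixResolution GroupRing QuaternionPair

section Cohomology

lemma isAugmentation_gluing : gluing.IsAugmentation
    (aug (ZMod 2) Gamma0SqrtNegTwo : MonoidAlgebra (ZMod 2) Gamma0SqrtNegTwo →+* ZMod 2) where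
  map_i := aug_single _ _
  map_P_j := aug_single _ _
  map_Q_j := aug_single _ _
  map_t := aug_single _ _
  map_u := aug_single _ _

lemma isResolution_gluing : IsResolution (ZMod 2) Gamma0SqrtNegTwo
    (fun n => (Fin (rk n) ⊕ Fin (rk n)) ⊕ Shift (fun _ => Fin 3) n ⊕
      Shift (Shift fun _ => Fin 1) n) gluing.columns.total :=
  Gluing.isResolution_columns isAcyclic_gluing isAugmentation_gluing
    fun _ => mem_span_of_aug_eq_zero

end Cohomology

end BianchiTwo

end

open BianchiTwo MatrixResolution QuaternionPair.Gluing

theorem mainTheorem3 :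
    (∀ p : ℕ, Module.Finite (ZMod 2) (cohomologyGamma0SqrtNegTwo p)) ∧
    Module.finrank (ZMod 2) (cohomologyGamma0SqrtNegTwo 0) = 1 ∧
    Module.finrank (ZMod 2) (cohomologyGamma0SqrtNegTwo 1) = 4 ∧
    (∀ p : ℕ, 2 ≤ p → (p % 4 = 2 ∨ p % 4 = 3) →
      Module.finrank (ZMod 2) (cohomologyGamma0SqrtNegTwo p) = 6) ∧
    (∀ p : ℕ, 2 ≤ p → (p % 4 = 0 ∨ p % 4 = 1) →
      Module.finrank (ZMod 2) (cohomologyGamma0SqrtNegTwo p) = 5) := by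
  refine ⟨finite_groupCohomology isResolution_gluing,
    finrank_groupCohomology_zero isResolution_gluing isAugmentation_gluing,
    finrank_groupCohomology_one isResolution_gluing isAugmentation_gluing, ?_, ?_⟩ <;>
  intro p hp h <;>
  obtain ⟨n, rfl⟩ := Nat.exists_eq_add_of_le' hp <;>
  refine (finrank_groupCohomology_add_two isResolution_gluing isAugmentation_gluing n).trans ?_
  · exact if_pos (by omega)
  · exact if_neg (by omega)
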